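/- Let $n\ge 1$ and $d=2^n$. On $(\mathbb C^2)^{\otimes n}\cong\mathbb C^d$ let $X,Y,Z$ be the Pauli matrices and let, for $0\le j\le n-1$, $$\Gamma_{2j}=Y^{\otimes j}\otimes X\otimes \mathbb I^{\otimes(n-1-j)},\qquad \Gamma_{2j+1}=Y^{\otimes j}\otimes Z\otimes \mathbb I^{\otimes(n-1-j)},\qquad \Gamma_{2n}=i^{\,n}\,\Gamma_0\Gamma_1\cdots\Gamma_{2n-1}.$$ For $A=\{k_1<\dots<k_\ell\}\subseteq\{0,\dots,2n-1\}$ put $\Gamma_A=i^{\ell(\ell-1)/2}\,\Gamma_{k_1}\cdots\Gamma_{k_\ell}$ (a Hermitian unitary), and let $\mathcal S=\{\Gamma_A : A\subseteq\{0,\dots,2n-1\}\}$. Let $L$ be a prime with $2\le L\le 2n+1$ such that $L$ divides $n$ or $L=2n+1$. Then there exist a unitary $U$ on $\mathbb C^d$, sets $\mathcal C_0,\dots,\mathcal C_{L-1}\subseteq\mathcal S\setminus\{\mathbb I\}$ and orthonormal bases $\mathcal B_j=\{|b^{(j)}\rangle\}_{b=0}^{d-1}$ of $\mathbb C^d$,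 $0\le j\le L-1$, such that, with indices $j$ read modulo $L$: 1. $U$ cyclically permutes the generators under conjugation: if $L=2n+1$, then $U\Gamma_kU^\dagger=\Gamma_{(k+1)\bmod L}$ for $0\le k\le 2n$; if $L$ divides $n$, then $U\Gamma_{aL+c}U^\dagger=\Gamma_{aL+((c+1)\bmod L)}$ for $0\le a<2n/L$ and $0\le c<L$ (in particular $\Gamma_0\to\Gamma_1\to\dots\to\Gamma_{L-1}\to\Gamma_0$), and $U\Gamma_{2n}U^\dagger=\Gamma_{2n}$. 2. $|\mathcal C_j|=d-1$, the elements of $\mathcal C_j$ commute with each other, exactly one of $\Gamma_0,\dots,\Gamma_{2n}$ lies in $\mathcal C_j$, and $\mathcal C_j\cap\mathcal C_k=\emptyset$ for $j\ne k$. 3. $U$ permutes the classes: for every $P\in\mathcal C_j$, either $UPU^\dagger$ or $-UPU^\dagger$ lies in $\mathcal C_{j+1}$. 4. Every vector of $\mathcal B_j$ is an eigenvector of every element of $\mathcal C_j$. 5. The bases are mutually unbiased: $|\langle a^{(j)}|b^{(k)}\rangle|=1/\sqrt d$ for all $a,b$ and all $j\ne k$. 6. $U\mathcal B_j=\mathcal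 B_{j+1}$; more precisely $U|b^{(j)}\rangle=|b^{(j+1)}\rangle$ for all $b$ and $j$. -/

import Mathlib

namespace CyclicMUB

/-- The Pauli matrix `X`. -/
def pauliX : Matrix (Fin 2) (Fin 2) ℂ := !![0, 1; 1, 0]

/-- The Pauli matrix `Y`. -/
def pauliY : Matrix (Fin 2) (Fin 2) ℂ := !![0, -Complex.I; Complex.I, 0]

/-- The Pauli matrix `Z`. -/
def pauliZ : Matrix (Fin 2) (Fin 2) ℂ := !![1, 0; 0, -1]

/-- The Hilbert space `(ℂ²)^{⊗ n}` of `n` qubits, in the computational basis indexed by bit strings;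
its dimension is `d = 2 ^ n`. -/
abbrev Qubits (n : ℕ) : Type := EuclideanSpace ℂ (Fin n → Fin 2)

/-- Operators on `n` qubits, as matrices in the computational basis. -/
abbrev Op (n : ℕ) : Type := Matrix (Fin n → Fin 2) (Fin n → Fin 2) ℂ

/-- The tensor product `M₀ ⊗ M₁ ⊗ ⋯ ⊗ M_{n-1}` of single-qubit matrices. -/
def tensor {n : ℕ} (M : Fin n → Matrix (Fin 2) (Fin 2) ℂ) : Op n :=
  Matrix.of fun x y => ∏ m, M m (x m) (y m)

/-- The Jordan–Wigner generators: for `j < n`,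
`jordanWigner n (2j) = Y^{⊗ j} ⊗ X ⊗ 1^{⊗ (n-1-j)}` and
`jordanWigner n (2j+1) = Y^{⊗ j} ⊗ Z ⊗ 1^{⊗ (n-1-j)}`. -/
def jordanWigner (n k : ℕ) : Op n :=
  tensor fun m =>
    if (m : ℕ) < k / 2 then pauliY
    else if (m : ℕ) = k / 2 then (if k % 2 = 0 then pauliX else pauliZ)
    else 1

/-- The Clifford generators `Γ_0, …, Γ_{2n-1}`, and `Γ_{2n} = i^n Γ_0 Γ_1 ⋯ Γ_{2n-1}`.
Only the indices `k ≤ 2n` are meaningful. -/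
noncomputable def Γ (n k : ℕ) : Op n :=
  if k < 2 * n then jordanWigner n k
  else Complex.I ^ n • (List.ofFn fun i : Fin (2 * n) => jordanWigner n i).prod

/-- The product of the generators `Γ_k`, `k ∈ A ⊆ {0, …, 2n-1}`, in increasing order, with the phase
`i^{|A|(|A|-1)/2}` that makes it Hermitian. -/
noncomputable def cliffordProduct (n : ℕ) (A : Finset (Fin (2 * n))) : Op n :=
  Complex.I ^ (A.card.choose 2) •
    (List.ofFn fun k : Fin (2 * n) => if k ∈ A then Γ n k else 1).prod

/-- The set `𝒮 = {1, Γ_j, i Γ_j Γ_k, …, Γ_{2n}}` of all Clifford products. -/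
def cliffordProducts (n : ℕ) : Set (Op n) := Set.range (cliffordProduct n)

/-- The permutation of indices that cyclically permutes each of the consecutive blocks
`{aL, aL+1, …, aL+L-1}` of length `L`. -/
def blockShift (L k : ℕ) : ℕ := L * (k / L) + (k % L + 1) % L

/-- `U` cyclically permutes the generators by conjugation: if `L = 2n+1` it cycles through all of
`Γ_0, …, Γ_{2n}`; if `L ∣ n` it cycles through each of the `2n/L` consecutive blocks of `L`
generators among `Γ_0, …, Γ_{2n-1}` and leaves `Γ_{2n}` invariant. -/
def CyclesGenerators (n L : ℕ) (U : Op n) : Prop :=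
  (L = 2 * n + 1 → ∀ k < L, U * Γ n k * U.conjTranspose = Γ n ((k + 1) % L)) ∧
  (L ∣ n → (∀ k < 2 * n, U * Γ n k * U.conjTranspose = Γ n (blockShift L k)) ∧
    U * Γ n (2 * n) * U.conjTranspose = Γ n (2 * n))

/-- Two orthonormal bases of `(ℂ²)^{⊗ n}` are mutually unbiased. -/
def MutuallyUnbiased {n : ℕ} (B B' : OrthonormalBasis (Fin (2 ^ n)) ℂ (Qubits n)) : Prop :=
  ∀ a b, ‖inner ℂ (B a) (B' b)‖ = 1 / Real.sqrt ((2 : ℝ) ^ n)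

end CyclicMUB

/-!
Sending a Clifford product to its syndrome, the vector of signs with which it commutes with
`Γ_0, …, Γ_{2n}`, identifies the products with the vectors of even weight in `𝔽₂ ^ (2n+1)`; two
products commute iff the dot product of their syndromes vanishes. An involution `τ` of
`{0, …, 2n}` with a single fixed point therefore yields a class of `2 ^ n` commuting products: those
with `τ`-invariant syndrome. The classes of two such involutions share only the identity as soon as
the involutions together act transitively, and then trace orthogonality of the products makes their
joint eigenbases mutually unbiased.

An even permutation `σ` of the generators is implemented by a product of reflections, which can be
rescaled so that its order `L` is that of `σ`. It remains to find `τ` for which `τ` and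
`σ ^ j * τ * σ ^ (-j)` act transitively whenever `L ∤ j`. If `L = 2n + 1`, then `τ x = -x` works:
the two reflections generate a dihedral group, which contains a nontrivial translation. If `L ∣ n`,
the generators form `n / L` pairs of blocks of length `L` besides the fixed point `2n`; an
involution of one pair of blocks with two fixed points serves as a link, and the links are chained
to `2n`.
-/

namespace CyclicMUB

open Matrix

section SignCommute

variable {R : Type*} [Ring R] {S T T' : R} {a b : ZMod 2}

/-- `S` and `T` commute up to the sign `(-1) ^ a`. The exponent lives in `ZMod 2` so that the signs
of products are computed by linear algebra over the field with two elements. -/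
def SignCommute (a : ZMod 2) (S T : R) : Prop := S * T = (-1 : ℤˣ) ^ a • (T * S)

theorem signCommute_zero_iff : SignCommute 0 S T ↔ Commute S T := by
  rw [SignCommute, uzpow_zero, one_smul, commute_iff_eq]

theorem signCommute_one_iff : SignCommute 1 S T ↔ S * T = -(T * S) := by
  rw [SignCommute, uzpow_one, Units.neg_smul, one_smul]

theorem eq_zero_or_eq_one (a : ZMod 2) : a = 0 ∨ a = 1 := by
  revert a
  decide

theorem neg_one_uzpow_smul_cancel {M : Type*} [AddCommGroup M] (a : ZMod 2) (x : M) :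
    (-1 : ℤˣ) ^ a • (-1 : ℤˣ) ^ a • x = x := by
  rw [smul_smul, Int.units_mul_self, one_smul]

namespace SignCommute

theorem refl (S : R) : SignCommute 0 S S :=
  signCommute_zero_iff.2 (Commute.refl S)

theorem one_right (S : R) : SignCommute 0 S 1 :=
  signCommute_zero_iff.2 (Commute.one_right S)

theorem symm (h : SignCommute a S T) : SignCommute a T S := by
  rw [SignCommute, h, neg_one_uzpow_smul_cancel]

theorem mul_right (h : SignCommute a S T) (h' : SignCommute b S T') :
    SignCommute (a + b) S (T * T') := by
  rw [SignCommute, ← mul_assoc, h, smul_mul_assoc, mul_assoc, h', mul_smul_comm, smul_smul,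
    ← uzpow_add, mul_assoc]

theorem list_prod_map_right {ι : Type*} {e : ι → ZMod 2} {g : ι → R} :
    ∀ {l : List ι}, (∀ i ∈ l, SignCommute (e i) S (g i)) →
      SignCommute (l.map e).sum S (l.map g).prod
  | [], _ => one_right S
  | _ :: _, h => (h _ List.mem_cons_self).mul_right
      (list_prod_map_right fun i hi => h i (List.mem_cons_of_mem _ hi))

theorem smul_right {K : Type*} [CommSemiring K] [Algebra K R] (h : SignCommute a S T) (c : K) :
    SignCommute a S (c • T) := by
  rw [SignCommute, mul_smul_comm, h, smul_mul_assoc, smul_comm]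

end SignCommute

theorem trace_eq_zero_of_signCommute_one {m K : Type*} [Fintype m] [DecidableEq m] [Field K]
    [CharZero K] {T G : Matrix m m K} (hG : G * G = 1) (h : SignCommute 1 T G) : T.trace = 0 := by
  have conj_eq_neg : G * T * G = -T := by
    rw [mul_assoc, signCommute_one_iff.1 h, mul_neg, ← mul_assoc, hG, one_mul]
  have trace_conj : (G * T * G).trace = T.trace := by
    rw [trace_mul_comm, ← mul_assoc, hG, one_mul]
  rw [conj_eq_neg, trace_neg] at trace_conj
  exact self_eq_neg.1 trace_conj.symm

theorem star_list_prod_of_pairwise_signCommute [StarRing R] :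
    ∀ {l : List R}, (∀ x ∈ l, IsSelfAdjoint x) → l.Pairwise (SignCommute 1) →
      star l.prod = (-1 : ℤˣ) ^ l.length.choose 2 • l.prod
  | [], _, _ => by simp
  | x :: l, hl, h => by
    have ih := star_list_prod_of_pairwise_signCommute
      (fun y hy => hl y (List.mem_cons_of_mem _ hy)) (List.pairwise_cons.1 h).2
    have swap : SignCommute l.length l.prod x := by
      simpa using (SignCommute.list_prod_map_right (e := fun _ => 1) (g := id)
        (List.pairwise_cons.1 h).1).symm
    rw [List.prod_cons, star_mul, ih, (hl x List.mem_cons_self).star_eq, smul_mul_assoc, swap,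
      uzpow_natCast, smul_smul, ← pow_add, List.length_cons, Nat.choose_succ_succ' _ 1,
      Nat.choose_one_right, add_comm]

section StarAlgebra

variable [StarRing R] [Algebra ℂ R] [StarModule ℂ R]

theorem isSelfAdjoint_I_pow_smul_list_prod {l : List R} (hl : ∀ x ∈ l, IsSelfAdjoint x)
    (h : l.Pairwise (SignCommute 1)) :
    IsSelfAdjoint (Complex.I ^ l.length.choose 2 • l.prod) := by
  have star_I_pow (c : ℕ) : star (Complex.I ^ c) = (-1) ^ c * Complex.I ^ c := by
    rw [star_pow, Complex.star_def, Complex.conj_I, neg_pow]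
  have sign_smul (c : ℕ) (x : R) : (-1 : ℤˣ) ^ c • x = (-1 : ℂ) ^ c • x := by
    rcases neg_one_pow_eq_or ℤˣ c with hc | hc <;> rcases Nat.even_or_odd c with h' | h' <;>
      simp_all [h'.neg_one_pow]
  rw [IsSelfAdjoint, star_smul, star_list_prod_of_pairwise_signCommute hl h, star_I_pow, sign_smul,
    smul_smul, mul_right_comm, ← pow_add, ← two_mul, pow_mul]
  simp

theorem I_pow_smul_list_prod_mem_unitary {l : List R} (hl : ∀ x ∈ l, x ∈ unitary R) (c : ℕ) :
    Complex.I ^ c • l.prod ∈ unitary R :=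
  Unitary.smul_mem_of_mem (pow_mem (by simp [Unitary.mem_iff]) c) (list_prod_mem hl)

end StarAlgebra

end SignCommute

section CliffordFamily

/-- A family of pairwise anticommuting self-adjoint involutions: the images of orthonormal vectors
in a representation of a Clifford algebra. -/
structure IsCliffordFamily {R ι : Type*} [Ring R] [StarRing R] (g : ι → R) : Prop where
  isSelfAdjoint : ∀ i, IsSelfAdjoint (g i)
  mul_self : ∀ i, g i * g i = 1
  anticommute : ∀ {i j}, i ≠ j → SignCommute 1 (g i) (g j)

variable {R ι : Type*} [Ring R] [StarRing R] {g : ι → R}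

namespace IsCliffordFamily

theorem mem_unitary (hg : IsCliffordFamily g) (i : ι) : g i ∈ unitary R := by
  simp [Unitary.mem_iff, (hg.isSelfAdjoint i).star_eq, hg.mul_self i]

theorem signCommute [DecidableEq ι] (hg : IsCliffordFamily g) (i j : ι) :
    SignCommute (if i = j then 0 else 1) (g i) (g j) := by
  split_ifs with h
  · rw [h]
    exact SignCommute.refl _
  · exact hg.anticommute h

theorem pairwise_map (hg : IsCliffordFamily g) {l : List ι} (hl : l.Nodup) :
    (l.map g).Pairwise (SignCommute 1) :=
  List.pairwise_map.2 (hl.imp fun h => hg.anticommute h)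

theorem mul_eq_neg (hg : IsCliffordFamily g) {i j : ι} (h : i ≠ j) : g i * g j = -(g j * g i) :=
  signCommute_one_iff.1 (hg.anticommute h)

end IsCliffordFamily

variable [Algebra ℂ R]

/-- The unit vector `(g i - g j) / √2` of a Clifford family: conjugation by it is, up to sign, the
reflection that exchanges `g i` and `g j`. -/
noncomputable def reflection (g : ι → R) (i j : ι) : R := ((√2 : ℝ) : ℂ)⁻¹ • (g i - g j)

theorem reflection_mem_unitary [StarModule ℂ R] (hg : IsCliffordFamily g) {i j : ι} (hij : i ≠ j) :
    reflection g i j ∈ unitary R := by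
  have sq : (g i - g j) * (g i - g j) = (2 : ℂ) • 1 := by
    rw [two_smul, sub_mul, mul_sub, mul_sub, hg.mul_self, hg.mul_self, hg.mul_eq_neg hij]
    abel
  have star_eq : star (reflection g i j) = reflection g i j := by
    simp [reflection, star_smul, (hg.isSelfAdjoint _).star_eq]
  have mul_self : reflection g i j * reflection g i j = 1 := by
    rw [reflection, smul_mul_smul_comm, sq, smul_smul, ← mul_inv, ← Complex.ofReal_mul,
      Real.mul_self_sqrt zero_le_two, Complex.ofReal_ofNat, inv_mul_cancel₀ two_ne_zero, one_smul]
  rw [Unitary.mem_iff, star_eq, and_self, mul_self]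

theorem reflection_mul [DecidableEq ι] (hg : IsCliffordFamily g) {i j : ι} (hij : i ≠ j) (x : ι) :
    reflection g i j * g x = -(g (Equiv.swap i j x) * reflection g i j) := by
  rw [reflection, smul_mul_assoc, mul_smul_comm, ← smul_neg]
  congr 1
  rcases eq_or_ne x i with rfl | hi
  · rw [Equiv.swap_apply_left, sub_mul, mul_sub, hg.mul_self, hg.mul_self, neg_sub]
  rcases eq_or_ne x j with rfl | hj
  · rw [Equiv.swap_apply_right, sub_mul, mul_sub, hg.mul_self, hg.mul_self, neg_sub]
  · rw [Equiv.swap_apply_of_ne_of_ne hi hj, sub_mul, mul_sub, hg.mul_eq_neg hi.symm,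
      hg.mul_eq_neg hj.symm]
    abel

theorem exists_unitary_mul_eq_sign_smul [StarModule ℂ R] [Fintype ι] [DecidableEq ι]
    (hg : IsCliffordFamily g) (π : Equiv.Perm ι) :
    ∃ V : unitary R, ∀ i, (V : R) * g i = Equiv.Perm.sign π • (g (π i) * V) := by
  induction π using Equiv.Perm.swap_induction_on with
  | one => exact ⟨1, by simp⟩
  | swap_mul π i j hij ih =>
    obtain ⟨V, hV⟩ := ih
    refine ⟨⟨_, reflection_mem_unitary hg hij⟩ * V, fun x => ?_⟩
    rw [Equiv.Perm.sign_mul, Equiv.Perm.sign_swap hij, Equiv.Perm.mul_apply, Submonoid.coe_mul,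
      mul_assoc, hV, mul_smul_comm, ← mul_assoc, reflection_mul hg hij, neg_mul, mul_assoc,
      smul_neg, neg_one_mul, Units.neg_smul]

end CliffordFamily

section JordanWigner

theorem isCliffordFamily_pauli : IsCliffordFamily ![pauliX, pauliY, pauliZ] where
  isSelfAdjoint i := by
    fin_cases i <;> ext a b <;> fin_cases a <;> fin_cases b <;> simp [pauliX, pauliY, pauliZ]
  mul_self i := by
    fin_cases i <;> ext a b <;> fin_cases a <;> fin_cases b <;> simp [pauliX, pauliY, pauliZ]
  anticommute {i j} hij := by
    rw [signCommute_one_iff]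
    fin_cases i <;> fin_cases j <;> first | exact absurd rfl hij | skip
    all_goals
      ext a b
      fin_cases a <;> fin_cases b <;> simp [pauliX, pauliY, pauliZ]

variable {n : ℕ}

theorem tensor_mul (M N : Fin n → Matrix (Fin 2) (Fin 2) ℂ) :
    tensor M * tensor N = tensor fun m => M m * N m := by
  ext x y
  simp only [tensor, mul_apply, of_apply, ← Finset.prod_mul_distrib]
  rw [Finset.prod_univ_sum, Fintype.piFinset_univ]

theorem tensor_one : tensor (fun _ : Fin n => 1) = 1 := by
  ext x y
  simp only [tensor, of_apply, one_apply, Finset.prod_ite_zero]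
  simp [funext_iff]

theorem star_tensor (M : Fin n → Matrix (Fin 2) (Fin 2) ℂ) :
    star (tensor M) = tensor fun m => star (M m) := by
  ext x y
  simp [tensor, star_apply]

theorem tensor_neg_one_uzpow_smul (e : Fin n → ZMod 2) (M : Fin n → Matrix (Fin 2) (Fin 2) ℂ) :
    tensor (fun m => (-1 : ℤˣ) ^ e m • M m) = (-1 : ℤˣ) ^ (∑ m, e m) • tensor M := by
  have uzpow_sum : (-1 : ℤˣ) ^ (∑ m, e m) = ∏ m, (-1 : ℤˣ) ^ e m := by
    induction (Finset.univ : Finset (Fin n)) using Finset.cons_induction with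
    | empty => simp
    | cons m s hm ih => rw [Finset.sum_cons, Finset.prod_cons, uzpow_add, ih]
  ext x y
  simp [uzpow_sum, tensor, Units.smul_def, Finset.prod_mul_distrib]

theorem SignCommute.tensor {e : Fin n → ZMod 2} {M N : Fin n → Matrix (Fin 2) (Fin 2) ℂ}
    (h : ∀ m, SignCommute (e m) (M m) (N m)) :
    SignCommute (∑ m, e m) (tensor M) (tensor N) := by
  rw [SignCommute, tensor_mul, tensor_mul, ← tensor_neg_one_uzpow_smul]
  exact congrArg _ (funext h)

/-- The factor at the site `m` of the `k`-th Jordan–Wigner generator. -/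
def jordanWignerFactor (k m : ℕ) : Matrix (Fin 2) (Fin 2) ℂ :=
  if m < k / 2 then pauliY
  else if m = k / 2 then (if k % 2 = 0 then pauliX else pauliZ)
  else 1

theorem jordanWigner_eq_tensor (n k : ℕ) :
    jordanWigner n k = tensor fun m => jordanWignerFactor k m := rfl

theorem isSelfAdjoint_jordanWignerFactor (k m : ℕ) : IsSelfAdjoint (jordanWignerFactor k m) := by
  unfold jordanWignerFactor
  split_ifs
  exacts [isCliffordFamily_pauli.isSelfAdjoint 1, isCliffordFamily_pauli.isSelfAdjoint 0,
    isCliffordFamily_pauli.isSelfAdjoint 2, IsSelfAdjoint.one _]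

theorem jordanWignerFactor_mul_self (k m : ℕ) :
    jordanWignerFactor k m * jordanWignerFactor k m = 1 := by
  unfold jordanWignerFactor
  split_ifs
  exacts [isCliffordFamily_pauli.mul_self 1, isCliffordFamily_pauli.mul_self 0,
    isCliffordFamily_pauli.mul_self 2, one_mul 1]

theorem signCommute_jordanWignerFactor {k l : ℕ} (hkl : k < l) (m : ℕ) :
    SignCommute (if m = k / 2 then 1 else 0) (jordanWignerFactor k m) (jordanWignerFactor l m) := by
  have pauli := @isCliffordFamily_pauli.anticommute
  rcases lt_trichotomy m (k / 2) with h | rfl | h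
  · simp only [jordanWignerFactor, if_pos h, if_neg h.ne, if_pos (show m < l / 2 by omega)]
    exact SignCommute.refl _
  · simp only [jordanWignerFactor, if_true, lt_irrefl, if_false]
    split_ifs
    any_goals omega
    exacts [pauli (i := 0) (j := 1) (by decide), pauli (i := 0) (j := 2) (by decide),
      pauli (i := 2) (j := 1) (by decide)]
  · simp only [jordanWignerFactor, if_neg h.ne', if_neg h.not_gt]
    exact (SignCommute.one_right _).symm

theorem jordanWigner_anticommute_of_lt {k l : ℕ} (hkl : k < l) (hk : k < 2 * n) :
    SignCommute 1 (jordanWigner n k) (jordanWigner n l) := by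
  have h := SignCommute.tensor fun m : Fin n => signCommute_jordanWignerFactor hkl m
  have val_eq_iff (m : Fin n) : (m : ℕ) = k / 2 ↔ m = ⟨k / 2, by omega⟩ := by rw [Fin.ext_iff]
  simpa only [jordanWigner_eq_tensor, val_eq_iff, Finset.sum_ite_eq', Finset.mem_univ, if_true]
    using h

theorem isCliffordFamily_jordanWigner (n : ℕ) :
    IsCliffordFamily fun k : Fin (2 * n) => jordanWigner n k where
  isSelfAdjoint k := by
    rw [IsSelfAdjoint, jordanWigner_eq_tensor, star_tensor]
    exact congrArg _ (funext fun m => (isSelfAdjoint_jordanWignerFactor k m).star_eq)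
  mul_self k := by
    simp only [jordanWigner_eq_tensor, tensor_mul, jordanWignerFactor_mul_self, tensor_one]
  anticommute {k l} hkl := by
    rcases hkl.lt_or_gt with h | h
    · exact jordanWigner_anticommute_of_lt h k.2
    · exact (jordanWigner_anticommute_of_lt h l.2).symm

end JordanWigner

section CliffordProduct

variable {n : ℕ}

theorem Γ_coe (k : Fin (2 * n)) : Γ n k = jordanWigner n k := if_pos k.2

theorem list_prod_map_ite_one {ι M : Type*} [Monoid M] (p : ι → Prop) [DecidablePred p] (g : ι → M)
    (l : List ι) : (l.map fun i => if p i then g i else 1).prod = ((l.filter p).map g).prod := by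
  induction l with
  | nil => rfl
  | cons i l ih =>
    by_cases hi : p i <;> simp [hi, ih]

theorem filter_finRange_eq_sort {N : ℕ} (A : Finset (Fin N)) :
    (List.finRange N).filter (· ∈ A) = A.sort := by
  have sorted : ((List.finRange N).filter (· ∈ A)).Pairwise (· ≤ ·) :=
    ((List.sortedLT_finRange N).pairwise.filter _).imp le_of_lt
  rw [← (List.toFinset_sort _ ((List.nodup_finRange N).filter _)).2 sorted]
  simp

theorem cliffordProduct_eq (A : Finset (Fin (2 * n))) :
    cliffordProduct n A =
      Complex.I ^ (A.sort.map fun k : Fin (2 * n) => jordanWigner n k).length.choose 2 •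
        (A.sort.map fun k : Fin (2 * n) => jordanWigner n k).prod := by
  rw [cliffordProduct, List.ofFn_eq_map, list_prod_map_ite_one, filter_finRange_eq_sort,
    List.length_map, Finset.length_sort]
  congr 2
  exact List.map_congr_left fun k _ => Γ_coe k

theorem isSelfAdjoint_cliffordProduct (A : Finset (Fin (2 * n))) :
    IsSelfAdjoint (cliffordProduct n A) := by
  rw [cliffordProduct_eq]
  refine isSelfAdjoint_I_pow_smul_list_prod ?_ ((isCliffordFamily_jordanWigner n).pairwise_map
    (A.sort_nodup _))
  simpa using fun k _ => (isCliffordFamily_jordanWigner n).isSelfAdjoint k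

theorem cliffordProduct_mul_self (A : Finset (Fin (2 * n))) :
    cliffordProduct n A * cliffordProduct n A = 1 := by
  have mem_unitary : cliffordProduct n A ∈ unitary (Op n) := by
    rw [cliffordProduct_eq]
    refine I_pow_smul_list_prod_mem_unitary ?_ _
    simpa using fun k _ => (isCliffordFamily_jordanWigner n).mem_unitary k
  nth_rw 1 [← (isSelfAdjoint_cliffordProduct A).star_eq]
  exact Unitary.star_mul_self_of_mem mem_unitary

theorem SignCommute.cliffordProduct_right {T : Op n} {e : Fin (2 * n) → ZMod 2}
    {A : Finset (Fin (2 * n))} (h : ∀ k ∈ A, SignCommute (e k) T (Γ n k)) :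
    SignCommute (∑ k ∈ A, e k) T (cliffordProduct n A) := by
  have sum_eq : ∑ k ∈ A, e k = (A.sort.map e).sum := by
    rw [← List.sum_toFinset e (A.sort_nodup _), A.sort_toFinset]
  rw [cliffordProduct_eq, sum_eq]
  refine (list_prod_map_right fun k hk => ?_).smul_right _
  rw [← Γ_coe]
  exact h k ((A.mem_sort _).1 hk)

theorem cliffordProduct_empty (n : ℕ) : cliffordProduct n ∅ = 1 := by
  simp [cliffordProduct_eq]

theorem cliffordProduct_singleton (k : Fin (2 * n)) : cliffordProduct n {k} = Γ n k.castSucc := by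
  simp [cliffordProduct_eq, Γ_coe]

theorem cliffordProduct_univ (n : ℕ) :
    cliffordProduct n Finset.univ = Γ n (Fin.last (2 * n)) := by
  have choose_eq : (2 * n).choose 2 = 4 * n.choose 2 + n := by
    have cast_eq : (((2 * n).choose 2 : ℕ) : ℚ) = (4 * n.choose 2 + n : ℕ) := by
      push_cast [Nat.cast_choose_two]
      ring
    exact_mod_cast cast_eq
  simp only [cliffordProduct, Γ, Finset.mem_univ, if_true, Fin.is_lt, Finset.card_univ,
    Fintype.card_fin, Fin.val_last, lt_irrefl, if_false, choose_eq, pow_add, pow_mul,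
    Complex.I_pow_four, one_pow, one_mul]

theorem sum_ite_zero_one {ι : Type*} [DecidableEq ι] (A : Finset ι) (j : ι) :
    ∑ k ∈ A, (if j = k then 0 else 1 : ZMod 2) = A.card + if j ∈ A then 1 else 0 := by
  have ite_eq (k : ι) : (if j = k then 0 else 1 : ZMod 2) = 1 + if j = k then 1 else 0 := by
    split_ifs <;> decide
  simp [ite_eq, Finset.sum_add_distrib]

theorem isCliffordFamily_Γ (n : ℕ) : IsCliffordFamily fun x : Fin (2 * n + 1) => Γ n x where
  isSelfAdjoint := Fin.lastCases
    (cliffordProduct_univ n ▸ isSelfAdjoint_cliffordProduct _)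
    fun k => cliffordProduct_singleton k ▸ isSelfAdjoint_cliffordProduct _
  mul_self := Fin.lastCases
    (cliffordProduct_univ n ▸ cliffordProduct_mul_self _)
    fun k => cliffordProduct_singleton k ▸ cliffordProduct_mul_self _
  anticommute {x y} hxy := by
    have anticommute_last (k : Fin (2 * n)) :
        SignCommute 1 (Γ n k.castSucc) (Γ n (Fin.last (2 * n))) := by
      have h := SignCommute.cliffordProduct_right (A := Finset.univ) (T := Γ n k.castSucc)
        (e := fun l => if k = l then 0 else 1) fun l _ => by
          simpa only [Fin.val_castSucc, Γ_coe]
            using (isCliffordFamily_jordanWigner n).signCommute k l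
      simpa [cliffordProduct_univ, sum_ite_zero_one, CharTwo.two_eq_zero] using h
    induction x using Fin.lastCases with
    | last =>
      induction y using Fin.lastCases with
      | last => exact absurd rfl hxy
      | cast l => exact (anticommute_last l).symm
    | cast k =>
      induction y using Fin.lastCases with
      | last => exact anticommute_last k
      | cast l =>
        rw [Fin.val_castSucc, Fin.val_castSucc, Γ_coe, Γ_coe]
        exact (isCliffordFamily_jordanWigner n).anticommute fun h => hxy (congrArg _ h)

end CliffordProduct

section Syndrome

variable {n : ℕ}

/-- The syndrome of `A ⊆ {0, …, 2n-1}`: the signs with which `cliffordProduct n A` commutes with the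
generators `Γ_0, …, Γ_{2n}`. In contrast to `A` itself, it treats the `2n + 1` generators alike, so
permutations of the generators act on it by permuting coordinates. -/
def syndrome (A : Finset (Fin (2 * n))) (x : Fin (2 * n + 1)) : ZMod 2 :=
  ∑ k ∈ A, if x = k.castSucc then 0 else 1

theorem signCommute_Γ_cliffordProduct (A : Finset (Fin (2 * n))) (x : Fin (2 * n + 1)) :
    SignCommute (syndrome A x) (Γ n x) (cliffordProduct n A) :=
  SignCommute.cliffordProduct_right fun k _ => (isCliffordFamily_Γ n).signCommute x k.castSucc

theorem syndrome_last (A : Finset (Fin (2 * n))) : syndrome A (Fin.last (2 * n)) = A.card := by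
  simp [syndrome, (Fin.castSucc_ne_last _).symm]

theorem syndrome_castSucc (A : Finset (Fin (2 * n))) (k : Fin (2 * n)) :
    syndrome A k.castSucc = A.card + if k ∈ A then 1 else 0 := by
  simp only [syndrome, Fin.castSucc_inj, sum_ite_zero_one]

theorem sum_syndrome (A : Finset (Fin (2 * n))) : ∑ x, syndrome A x = 0 := by
  simp [Fin.sum_univ_castSucc, syndrome_last, syndrome_castSucc, Finset.sum_add_distrib,
    CharTwo.two_eq_zero, CharTwo.add_self_eq_zero]

theorem syndrome_injective : Function.Injective (syndrome (n := n)) := by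
  intro A B h
  ext k
  have h_last := congrFun h (Fin.last _)
  have h_castSucc := congrFun h k.castSucc
  rw [syndrome_last, syndrome_last] at h_last
  rw [syndrome_castSucc, syndrome_castSucc, h_last, add_left_cancel_iff] at h_castSucc
  by_cases hA : k ∈ A <;> by_cases hB : k ∈ B <;> simp_all

theorem exists_syndrome_eq {f : Fin (2 * n + 1) → ZMod 2} (hf : ∑ x, f x = 0) :
    ∃ A, syndrome A = f := by
  have ite_eq_one (a : ZMod 2) : (if a = 1 then 1 else 0) = a := by
    revert a
    decide
  refine ⟨Finset.univ.filter fun k => f k.castSucc + f (Fin.last _) = 1, ?_⟩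
  have card_eq : ((Finset.univ.filter fun k : Fin (2 * n) =>
      f k.castSucc + f (Fin.last _) = 1).card : ZMod 2) = f (Fin.last _) := by
    rw [Fin.sum_univ_castSucc] at hf
    simp [Finset.natCast_card_filter, ite_eq_one, Finset.sum_add_distrib, CharTwo.two_eq_zero,
      CharTwo.add_eq_zero.1 hf]
  ext x
  cases x using Fin.lastCases with
  | last => rw [syndrome_last, card_eq]
  | cast k =>
    simp only [syndrome_castSucc, card_eq, Finset.mem_filter, Finset.mem_univ, true_and, ite_eq_one]
    rw [add_left_comm, CharTwo.add_self_eq_zero, add_zero]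

theorem signCommute_cliffordProduct (A B : Finset (Fin (2 * n))) :
    SignCommute (∑ x, syndrome A x * syndrome B x) (cliffordProduct n A) (cliffordProduct n B) := by
  have sum_mul_ite (y : Fin (2 * n + 1)) :
      ∑ x, syndrome A x * (if x = y then 0 else 1) = syndrome A y := by
    have mul_ite_eq (x : Fin (2 * n + 1)) : syndrome A x * (if x = y then 0 else 1) =
        syndrome A x + if x = y then syndrome A x else 0 := by
      split_ifs <;> simp [CharTwo.add_self_eq_zero]
    simp [mul_ite_eq, Finset.sum_add_distrib, sum_syndrome]
  have sum_eq : ∑ x, syndrome A x * syndrome B x = ∑ k ∈ B, syndrome A k.castSucc := by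
    simp_rw [syndrome.eq_def B, Finset.mul_sum]
    rw [Finset.sum_comm]
    exact Finset.sum_congr rfl fun k _ => sum_mul_ite k.castSucc
  rw [sum_eq]
  exact SignCommute.cliffordProduct_right fun k _ =>
    (signCommute_Γ_cliffordProduct A k.castSucc).symm

theorem exists_cliffordProduct_eq_Γ (x : Fin (2 * n + 1)) :
    ∃ A, cliffordProduct n A = Γ n x ∧ ∀ y, syndrome A y = if y = x then 0 else 1 := by
  cases x using Fin.lastCases with
  | last =>
    refine ⟨Finset.univ, cliffordProduct_univ n, fun y => ?_⟩
    cases y using Fin.lastCases <;>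
      simp [syndrome_last, syndrome_castSucc, CharTwo.two_eq_zero, Fin.castSucc_ne_last]
  | cast k => exact ⟨{k}, cliffordProduct_singleton k, fun y => Finset.sum_singleton _ _⟩

end Syndrome

section TraceOrthogonal

/-- Hermitian involutive matrices that are pairwise orthogonal for the Hilbert–Schmidt inner
product, such as the Pauli matrices or the Clifford products. -/
structure IsTraceOrthogonal {m ι 𝕜 : Type*} [Fintype m] [DecidableEq m] [RCLike 𝕜]
    (P : ι → Matrix m m 𝕜) : Prop where
  isHermitian : ∀ a, (P a).IsHermitian
  mul_self : ∀ a, P a * P a = 1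
  trace_mul : ∀ {a b}, a ≠ b → (P a * P b).trace = 0

theorem mul_self_eq_one_of_mulVec_eq_smul {m K : Type*} [Fintype m] [DecidableEq m] [Field K]
    {G : Matrix m m K} (hG : G * G = 1) {v : m → K} (hv : v ≠ 0) {μ : K} (h : G *ᵥ v = μ • v) :
    μ * μ = 1 := by
  have smul_eq : (μ * μ) • v = (1 : K) • v := by
    rw [mul_smul, ← h, ← mulVec_smul, ← h, mulVec_mulVec, hG, one_mulVec, one_smul]
  exact smul_left_injective K hv smul_eq

theorem trace_vecMulVec_star_mul {m 𝕜 : Type*} [Fintype m] [RCLike 𝕜] (v w : m → 𝕜) :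
    (vecMulVec v (star v) * vecMulVec w (star w)).trace = (star v ⬝ᵥ w) * star (star v ⬝ᵥ w) := by
  rw [vecMulVec_mul_vecMulVec, trace_vecMulVec, star_dotProduct, star_star]
  simp [dotProduct_comm]

open scoped ComplexOrder in
theorem eq_of_isHermitian_of_trace_mul_eq {m 𝕜 : Type*} [Fintype m] [RCLike 𝕜] {A B : Matrix m m 𝕜}
    (hA : A.IsHermitian) (hB : B.IsHermitian) (hAB : (A * B).trace = (A * A).trace)
    (hBB : (B * B).trace = (A * A).trace) : A = B := by
  rw [← sub_eq_zero, ← trace_mul_conjTranspose_self_eq_zero_iff, (hA.sub hB).eq]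
  simp only [sub_mul, mul_sub, trace_sub, trace_mul_comm B A, hAB, hBB, sub_self]

variable {m ι 𝕜 : Type*} [Fintype m] [DecidableEq m] [RCLike 𝕜] {P : ι → Matrix m m 𝕜}

namespace IsTraceOrthogonal

theorem trace_mul_eq_ite [DecidableEq ι] (hP : IsTraceOrthogonal P) (a b : ι) :
    (P a * P b).trace = if a = b then (Fintype.card m : 𝕜) else 0 := by
  split_ifs with h
  · rw [h, hP.mul_self, trace_one]
  · exact hP.trace_mul h

theorem linearIndependent [Nonempty m] (hP : IsTraceOrthogonal P) : LinearIndependent 𝕜 P := by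
  classical
  refine linearIndependent_iff'.2 fun s c hc b hb => ?_
  have trace_eq := congrArg (fun T => (T * P b).trace) hc
  simpa [Finset.sum_mul, trace_sum, trace_smul, hP.trace_mul_eq_ite, hb] using trace_eq

theorem injective [Nonempty m] (hP : IsTraceOrthogonal P) : Function.Injective P :=
  hP.linearIndependent.injective

theorem exists_eq_smul_one_of_commute [Nonempty m] [Fintype ι] (hP : IsTraceOrthogonal P)
    (hcard : Fintype.card ι = Fintype.card m ^ 2) {T : Matrix m m 𝕜} (hT : ∀ a, Commute T (P a)) :
    ∃ c : 𝕜, T = c • 1 := by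
  have span_eq_top : Submodule.span 𝕜 (Set.range P) = ⊤ :=
    hP.linearIndependent.span_eq_top_of_card_eq_finrank' (by
      rw [hcard, Module.finrank_matrix, Module.finrank_self, mul_one, sq])
  have commute_all (M : Matrix m m 𝕜) : Commute T M := by
    have hM : M ∈ Submodule.span 𝕜 (Set.range P) := span_eq_top ▸ Submodule.mem_top
    induction hM using Submodule.span_induction with
    | mem _ h =>
      obtain ⟨a, rfl⟩ := h
      exact hT a
    | zero => exact Commute.zero_right T
    | add _ _ _ _ h h' => exact h.add_right h'
    | smul c _ _ h => exact h.smul_right c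
  obtain ⟨c, hc⟩ :=
    mem_range_scalar_iff_commute_single'.2 fun i j => (commute_all (single i j 1)).symm
  exact ⟨c, by rw [← hc, smul_one_eq_diagonal, scalar_apply]⟩

theorem trace_sum_smul_mul_sum_smul [DecidableEq ι] (hP : IsTraceOrthogonal P) (S T : Finset ι)
    (μ ν : ι → 𝕜) :
    ((∑ a ∈ S, μ a • P a) * ∑ b ∈ T, ν b • P b).trace =
      Fintype.card m * ∑ a ∈ S ∩ T, μ a * ν a := by
  simp only [Finset.sum_mul, Finset.mul_sum, trace_sum, smul_mul_smul_comm, trace_smul,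
    hP.trace_mul_eq_ite, smul_eq_mul, mul_ite, mul_zero, Finset.sum_ite_eq', Finset.sum_ite_mem]
  rw [Finset.inter_comm]
  exact Finset.sum_congr rfl fun a _ => mul_comm _ _

/-- Both sides are Hermitian of Hilbert–Schmidt norm `1`, and so is their inner product. -/
theorem vecMulVec_star_eq_sum [Nonempty m] (hP : IsTraceOrthogonal P) {S : Finset ι}
    (hS : S.card = Fintype.card m) {v : m → 𝕜} (hv : star v ⬝ᵥ v = 1) {μ : ι → 𝕜}
    (hμ : ∀ a ∈ S, P a *ᵥ v = μ a • v) :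
    vecMulVec v (star v) = (Fintype.card m : 𝕜)⁻¹ • ∑ a ∈ S, μ a • P a := by
  classical
  have v_ne_zero : v ≠ 0 := by
    rintro rfl
    simp at hv
  have μ_mul_self (a) (ha : a ∈ S) : μ a * μ a = 1 :=
    mul_self_eq_one_of_mulVec_eq_smul (hP.mul_self a) v_ne_zero (hμ a ha)
  have star_μ (a) (ha : a ∈ S) : star (μ a) = μ a := by
    rcases mul_self_eq_one_iff.1 (μ_mul_self a ha) with h | h <;> simp [h]
  have sum_μ : ∑ a ∈ S, μ a * μ a = Fintype.card m := by
    rw [Finset.sum_congr rfl μ_mul_self, Finset.sum_const, hS, nsmul_one]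
  have card_ne_zero : (Fintype.card m : 𝕜) ≠ 0 := Nat.cast_ne_zero.2 Fintype.card_ne_zero
  set E := vecMulVec v (star v) with hE
  have trace_E : E.trace = 1 := by rw [hE, trace_vecMulVec, dotProduct_comm, hv]
  have trace_EE : (E * E).trace = 1 := by simp [hE, trace_vecMulVec_star_mul, hv]
  have sum_mul_E : (∑ a ∈ S, μ a • P a) * E = (Fintype.card m : 𝕜) • E := by
    rw [← sum_μ, Finset.sum_smul, Finset.sum_mul]
    refine Finset.sum_congr rfl fun a ha => ?_
    rw [hE, smul_mul_assoc, mul_vecMulVec, hμ a ha, smul_vecMulVec, smul_smul]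
  refine eq_of_isHermitian_of_trace_mul_eq ?_ ?_ ?_ ?_
  · rw [IsHermitian, hE, conjTranspose_vecMulVec, star_star]
  · rw [IsHermitian, conjTranspose_smul, star_inv₀, star_natCast, conjTranspose_sum]
    congr 1
    refine Finset.sum_congr rfl fun a ha => ?_
    rw [conjTranspose_smul, (hP.isHermitian a).eq, star_μ a ha]
  · rw [trace_EE, mul_smul_comm, trace_smul, trace_mul_comm, sum_mul_E, trace_smul, trace_E,
      smul_smul, inv_mul_cancel₀ card_ne_zero, one_smul]
  · rw [trace_EE, smul_mul_smul_comm, trace_smul, hP.trace_sum_smul_mul_sum_smul, Finset.inter_self,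
      sum_μ, smul_eq_mul]
    field_simp

theorem exists_vecMulVec_star_eq_sum [Nonempty m] (hP : IsTraceOrthogonal P) {S : Finset ι}
    (hS : S.card = Fintype.card m) {e : ι} (he : P e = 1) (heS : e ∈ S) {v : EuclideanSpace 𝕜 m}
    (hv : ‖v‖ = 1) (hvS : ∀ a ∈ S, ∃ μ : 𝕜, toEuclideanLin (P a) v = μ • v) :
    ∃ μ : ι → 𝕜, μ e = 1 ∧
      vecMulVec v.ofLp (star v.ofLp) = (Fintype.card m : 𝕜)⁻¹ • ∑ a ∈ S, μ a • P a := by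
  have dot_eq_one : star v.ofLp ⬝ᵥ v.ofLp = 1 := by
    rw [dotProduct_comm, ← EuclideanSpace.inner_eq_star_dotProduct, inner_self_eq_norm_sq_to_K, hv]
    simp
  choose! μ hμ using hvS
  have mulVec_eq (a) (ha : a ∈ S) : P a *ᵥ v.ofLp = μ a • v.ofLp := by
    simpa using congrArg WithLp.ofLp (hμ a ha)
  refine ⟨μ, ?_, hP.vecMulVec_star_eq_sum hS dot_eq_one mulVec_eq⟩
  simpa [he, dot_eq_one] using (congrArg (star v.ofLp ⬝ᵥ ·) (mulVec_eq e heS)).symm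

theorem norm_inner_eq_of_inter_eq_singleton [Nonempty m] [DecidableEq ι] (hP : IsTraceOrthogonal P)
    {S T : Finset ι} (hS : S.card = Fintype.card m) (hT : T.card = Fintype.card m) {e : ι}
    (he : P e = 1) (hST : S ∩ T = {e}) {v w : EuclideanSpace 𝕜 m} (hv : ‖v‖ = 1) (hw : ‖w‖ = 1)
    (hvS : ∀ a ∈ S, ∃ μ : 𝕜, toEuclideanLin (P a) v = μ • v)
    (hwT : ∀ a ∈ T, ∃ μ : 𝕜, toEuclideanLin (P a) w = μ • w) :
    ‖inner 𝕜 v w‖ = 1 / √(Fintype.card m) := by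
  obtain ⟨heS, heT⟩ := Finset.mem_inter.1 (hST ▸ Finset.mem_singleton_self e : e ∈ S ∩ T)
  obtain ⟨μ, hμe, hμ⟩ := hP.exists_vecMulVec_star_eq_sum hS he heS hv hvS
  obtain ⟨ν, hνe, hν⟩ := hP.exists_vecMulVec_star_eq_sum hT he heT hw hwT
  have trace_eq := trace_vecMulVec_star_mul v.ofLp w.ofLp
  rw [hμ, hν, smul_mul_smul_comm, trace_smul, hP.trace_sum_smul_mul_sum_smul, hST,
    Finset.sum_singleton, hμe, hνe, dotProduct_comm, ← EuclideanSpace.inner_eq_star_dotProduct,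
    RCLike.star_def, RCLike.mul_conj] at trace_eq
  have card_ne_zero : (Fintype.card m : 𝕜) ≠ 0 := Nat.cast_ne_zero.2 Fintype.card_ne_zero
  have sq_norm : ‖inner 𝕜 v w‖ ^ 2 = (Fintype.card m : ℝ)⁻¹ := by
    apply RCLike.ofReal_injective (K := 𝕜)
    push_cast
    rw [← trace_eq, smul_eq_mul]
    field_simp
  rw [← Real.sqrt_sq (norm_nonneg (inner 𝕜 v w)), sq_norm, Real.sqrt_inv, one_div]

end IsTraceOrthogonal

theorem exists_orthonormalBasis_eigenvectors {𝕜 E ι : Type*} [RCLike 𝕜] [NormedAddCommGroup E]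
    [InnerProductSpace 𝕜 E] [FiniteDimensional 𝕜 E] {d : ℕ}
    (hd : Module.finrank 𝕜 E = d) {T : ι → E →ₗ[𝕜] E} (hT : ∀ i, (T i).IsSymmetric)
    (hc : Pairwise (Function.onFun Commute T)) :
    ∃ B : OrthonormalBasis (Fin d) 𝕜 E, ∀ b i, ∃ μ : 𝕜, T i (B b) = μ • B b := by
  classical
  have internal := LinearMap.IsSymmetric.directSum_isInternal_of_pairwise_commute hT hc
  have orthogonal := (LinearMap.IsSymmetric.orthogonalFamily_iInf_eigenspaces hT).comp
    (γ := {χ : ι → 𝕜 // (⨅ j, Module.End.eigenspace (T j) (χ j)) ≠ ⊥}) Subtype.val_injective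
  have internal' := DirectSum.isInternal_ne_bot_iff.2 internal
  have := internal.submodule_iSupIndep.fintypeNeBotOfFiniteDimensional
  refine ⟨internal'.subordinateOrthonormalBasis hd orthogonal, fun b i => ?_⟩
  have mem := internal'.subordinateOrthonormalBasis_subordinate hd b orthogonal
  exact ⟨_, Module.End.mem_eigenspace_iff.1 ((Submodule.mem_iInf _).1 mem i)⟩

theorem isTraceOrthogonal_cliffordProduct (n : ℕ) : IsTraceOrthogonal (cliffordProduct n) where
  isHermitian := isSelfAdjoint_cliffordProduct
  mul_self := cliffordProduct_mul_self
  trace_mul {A B} hAB := by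
    obtain ⟨x, hx⟩ := Function.ne_iff.1 (syndrome_injective.ne hAB)
    have h := ((signCommute_Γ_cliffordProduct A x).mul_right
      (signCommute_Γ_cliffordProduct B x)).symm
    rw [(eq_zero_or_eq_one _).resolve_left (CharTwo.add_eq_zero.not.2 hx)] at h
    exact trace_eq_zero_of_signCommute_one ((isCliffordFamily_Γ n).mul_self x) h

end TraceOrthogonal

section ImplementingUnitary

theorem exists_smul_pow_eq_one {R : Type*} [Ring R] [StarRing R] [Algebra ℂ R] [StarModule ℂ R]
    [Nontrivial R] {L : ℕ} (hL : 0 < L) {V : unitary R} {c : ℂ} (hV : (V : R) ^ L = c • 1) :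
    ∃ z : unitary ℂ, (z • V) ^ L = 1 := by
  have star_mul_self : star c * c = 1 := by
    have h := Unitary.coe_star_mul_self (V ^ L)
    rw [SubmonoidClass.coe_pow, hV, star_smul, star_one, smul_mul_smul_comm, one_mul,
      ← Algebra.algebraMap_eq_smul_one, ← map_one (algebraMap ℂ R)] at h
    exact FaithfulSMul.algebraMap_injective ℂ R h
  obtain ⟨z, hz⟩ := IsAlgClosed.exists_pow_nat_eq (star c) hL
  have norm_c : ‖c‖ = 1 := CStarRing.norm_of_mem_unitary
    (Unitary.mem_iff.2 ⟨star_mul_self, mul_comm c (star c) ▸ star_mul_self⟩)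
  have norm_z : ‖z‖ = 1 := (pow_eq_one_iff_of_nonneg (norm_nonneg z) hL.ne').1 <| by
    rw [← norm_pow, hz, norm_star, norm_c]
  have z_mem : z ∈ unitary ℂ := by
    simp [Unitary.mem_iff, Complex.mul_conj', Complex.conj_mul', norm_z]
  refine ⟨⟨z, z_mem⟩, Subtype.ext ?_⟩
  rw [SubmonoidClass.coe_pow, Unitary.coe_smul, Submonoid.smul_def, smul_pow, hV, smul_smul, hz,
    star_mul_self, one_smul, OneMemClass.coe_one]

variable {n : ℕ} {U U' : Matrix.unitaryGroup (Fin n → Fin 2) ℂ}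
  {π π' : Equiv.Perm (Fin (2 * n + 1))}

/-- Conjugation by the unitary `U` permutes the generators `Γ_0, …, Γ_{2n}` according to `π`. -/
def Implements (U : Matrix.unitaryGroup (Fin n → Fin 2) ℂ) (π : Equiv.Perm (Fin (2 * n + 1))) :
    Prop :=
  ∀ x : Fin (2 * n + 1), SemiconjBy (U : Op n) (Γ n x) (Γ n (π x))

theorem Implements.pow (h : Implements U π) : ∀ k : ℕ, Implements (U ^ k) (π ^ k)
  | 0, x => SemiconjBy.one_left _
  | k + 1, x => by
    rw [pow_succ, pow_succ]
    exact (h.pow k (π x)).mul_left (h x)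

theorem Implements.conj_Γ (h : Implements U π) (x : Fin (2 * n + 1)) :
    (U : Op n) * Γ n x * (U : Op n)ᴴ = Γ n (π x) := by
  rw [(h x).eq, mul_assoc, ← star_eq_conjTranspose, mem_unitaryGroup_iff.1 U.2, mul_one]

theorem exists_eq_smul_one_of_commute_Γ {T : Op n} (hT : ∀ x : Fin (2 * n + 1), Commute (Γ n x) T) :
    ∃ c : ℂ, T = c • 1 := by
  refine (isTraceOrthogonal_cliffordProduct n).exists_eq_smul_one_of_commute
    (by simp [pow_mul']) fun A => ?_
  have h : SignCommute (∑ _k ∈ A, 0) T (cliffordProduct n A) :=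
    SignCommute.cliffordProduct_right fun k _ => signCommute_zero_iff.2 (hT k.castSucc).symm
  rwa [Finset.sum_const_zero, signCommute_zero_iff] at h

theorem eq_or_eq_neg_cliffordProduct {T : Op n} (hT : T * T = 1) {B : Finset (Fin (2 * n))}
    (h : ∀ x, SignCommute (syndrome B x) (Γ n x) T) :
    T = cliffordProduct n B ∨ T = -cliffordProduct n B := by
  have commute (x : Fin (2 * n + 1)) : Commute (Γ n x) (T * cliffordProduct n B) := by
    rw [← signCommute_zero_iff, ← CharTwo.add_self_eq_zero (syndrome B x)]
    exact (h x).mul_right (signCommute_Γ_cliffordProduct B x)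
  obtain ⟨c, hc⟩ := exists_eq_smul_one_of_commute_Γ commute
  have T_eq : T = c • cliffordProduct n B := by
    rw [← mul_one T, ← cliffordProduct_mul_self B, ← mul_assoc, hc, smul_mul_assoc, one_mul]
  have mul_self : c * c = 1 := by
    rw [T_eq, smul_mul_smul_comm, cliffordProduct_mul_self] at hT
    simpa using congrFun (congrFun hT 0) 0
  rcases mul_self_eq_one_iff.1 mul_self with rfl | rfl
  · exact .inl (by rw [T_eq, one_smul])
  · exact .inr (by rw [T_eq, neg_one_smul])

theorem Implements.conj_cliffordProduct (h : Implements U π) {A B : Finset (Fin (2 * n))}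
    (hAB : ∀ x, syndrome B (π x) = syndrome A x) :
    (U : Op n) * cliffordProduct n A * (U : Op n)ᴴ = cliffordProduct n B ∨
      (U : Op n) * cliffordProduct n A * (U : Op n)ᴴ = -cliffordProduct n B := by
  set φ := Unitary.conjStarAlgAut ℂ (Op n) U
  change φ _ = _ ∨ φ _ = _
  refine eq_or_eq_neg_cliffordProduct ?_ fun x => ?_
  · rw [← map_mul, cliffordProduct_mul_self, map_one]
  · obtain ⟨y, rfl⟩ := π.surjective x
    have φ_Γ : φ (Γ n y) = Γ n (π y) := h.conj_Γ y
    rw [SignCommute, hAB, ← φ_Γ, ← map_mul, ← map_mul, signCommute_Γ_cliffordProduct A y]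
    exact map_zsmul φ _ _

theorem exists_implements_pow_eq_one {L : ℕ} (hL : 0 < L) {σ : Equiv.Perm (Fin (2 * n + 1))}
    (hσ : Equiv.Perm.sign σ = 1) (hσL : σ ^ L = 1) :
    ∃ U : Matrix.unitaryGroup (Fin n → Fin 2) ℂ, Implements U σ ∧ U ^ L = 1 := by
  obtain ⟨V, hV⟩ := exists_unitary_mul_eq_sign_smul (isCliffordFamily_Γ n) σ
  have V_implements : Implements V σ := fun x => (hV x).trans (by rw [hσ, one_smul])
  obtain ⟨c, hc⟩ : ∃ c : ℂ, (V : Op n) ^ L = c • 1 :=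
    exists_eq_smul_one_of_commute_Γ fun x => Commute.symm <| by
      have h := V_implements.pow L x
      rwa [hσL] at h
  obtain ⟨z, hz⟩ := exists_smul_pow_eq_one hL hc
  refine ⟨z • V, fun x => ?_, hz⟩
  rw [SemiconjBy, Unitary.coe_smul, smul_mul_assoc, mul_smul_comm, (V_implements x).eq]

/-- The isometry of `EuclideanSpace ℂ m` with a given unitary matrix, by which orthonormal bases can
be transported. -/
noncomputable def unitaryIsometry {m : Type*} [Fintype m] [DecidableEq m] :
    Matrix.unitaryGroup m ℂ →* (EuclideanSpace ℂ m ≃ₗᵢ[ℂ] EuclideanSpace ℂ m) :=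
  (Unitary.linearIsometryEquiv (𝕜 := ℂ) (H := EuclideanSpace ℂ m)).toMonoidHom.comp
    { toFun := Subtype.map (toEuclideanCLM (n := m) (𝕜 := ℂ)) fun _ => Unitary.map_mem _
      map_one' := Subtype.ext (map_one _)
      map_mul' := fun _ _ => Subtype.ext (map_mul _ _ _) }

theorem unitaryIsometry_apply {m : Type*} [Fintype m] [DecidableEq m]
    (U : Matrix.unitaryGroup m ℂ) (v : EuclideanSpace ℂ m) :
    unitaryIsometry U v = toEuclideanLin (U : Matrix m m ℂ) v :=
  rfl

end ImplementingUnitary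

section Pairing

theorem sum_eq_sum_fixed {P R : Type*} [Fintype P] [DecidableEq P] [Semiring R] [CharP R 2]
    {τ : P → P} (hτ : Function.Involutive τ) {f : P → R} (hf : ∀ x, f (τ x) = f x) :
    ∑ x, f x = ∑ x with τ x = x, f x := by
  rw [← Finset.sum_filter_add_sum_filter_not _ fun x => τ x = x]
  refine (congrArg _ ?_).trans (add_zero _)
  refine Finset.sum_involution (fun x _ => τ x) ?_ ?_ ?_ fun x _ => hτ x
  · exact fun x _ => by rw [hf, CharTwo.add_self_eq_zero]
  · exact fun x hx _ => (Finset.mem_filter.1 hx).2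
  · exact fun x hx => by simpa [hτ x, eq_comm] using hx

/-- `τ` is an involution whose only fixed point is `k`; it pairs up the other points. -/
structure IsPairing {P : Type*} (τ : Equiv.Perm P) (k : P) : Prop where
  involutive : Function.Involutive τ
  apply_eq_iff : ∀ x, τ x = x ↔ x = k

variable {P : Type*} {τ : Equiv.Perm P} {k : P}

namespace IsPairing

theorem apply_self (h : IsPairing τ k) : τ k = k :=
  (h.apply_eq_iff k).2 rfl

theorem permCongr {Q : Type*} (h : IsPairing τ k) (e : P ≃ Q) :
    IsPairing (e.permCongr τ) (e k) where
  involutive x := by simp [h.involutive _]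
  apply_eq_iff x := by
    rw [Equiv.permCongr_apply, ← Equiv.eq_symm_apply, h.apply_eq_iff, Equiv.symm_apply_eq]

theorem conj (h : IsPairing τ k) (π : Equiv.Perm P) : IsPairing (π * τ * π⁻¹) (π k) :=
  h.permCongr π

theorem sum_eq [Fintype P] (h : IsPairing τ k) {R : Type*} [Semiring R] [CharP R 2] {f : P → R}
    (hf : ∀ x, f (τ x) = f x) : ∑ x, f x = f k := by
  classical
  have fixed_eq : (Finset.univ.filter fun x => τ x = x) = {k} := by
    ext x
    simp [h.apply_eq_iff]
  rw [sum_eq_sum_fixed h.involutive hf, fixed_eq, Finset.sum_singleton]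

variable [LinearOrder P]

theorem eq_of_eq_of_lt_apply (h : IsPairing τ k) {α : Type*} {f g : P → α}
    (hf : ∀ x, f (τ x) = f x) (hg : ∀ x, g (τ x) = g x) (hk : f k = g k)
    (hlt : ∀ x, x < τ x → f x = g x) : f = g := by
  funext x
  rcases lt_trichotomy x (τ x) with hx | hx | hx
  · exact hlt x hx
  · rw [(h.apply_eq_iff x).1 hx.symm, hk]
  · rw [← hf, ← hg, hlt _ (by rwa [h.involutive x])]

theorem exists_extension (h : IsPairing τ k) {α : Type*} (g : {x // x < τ x} → α) (a : α) :
    ∃ f : P → α, (∀ x, f (τ x) = f x) ∧ f k = a ∧ ∀ x : {x // x < τ x}, f x = g x := by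
  refine ⟨fun x => if hx : x < τ x then g ⟨x, hx⟩
    else if hx : τ x < τ (τ x) then g ⟨τ x, hx⟩ else a, fun x => ?_, ?_, fun x => dif_pos x.2⟩
  · by_cases hx : x < τ x
    · simp only [h.involutive x, hx, hx.asymm, dite_true, dite_false]
    · simp only [hx, h.involutive x, dite_false]
  · simp [h.apply_self]

theorem two_mul_card_lt_apply_add_one [Fintype P] (h : IsPairing τ k) :
    2 * Fintype.card {x // x < τ x} + 1 = Fintype.card P := by
  have lt_iff (x : P) : ¬ x < τ x ∧ x ≠ k ↔ τ x < x := by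
    rw [Ne, ← h.apply_eq_iff, not_lt, ← Ne, ← lt_iff_le_and_ne]
  have image_eq : (Finset.univ.filter fun x => x < τ x).image τ =
      (Finset.univ.filter fun x => ¬ x < τ x).erase k := by
    ext x
    simp only [Finset.mem_image, Finset.mem_filter, Finset.mem_univ, true_and, Finset.mem_erase]
    rw [and_comm, lt_iff]
    exact ⟨fun ⟨y, hy, hyx⟩ => by rwa [← hyx, h.involutive y],
      fun hx => ⟨τ x, by rwa [h.involutive x], h.involutive x⟩⟩
  have card_eq := congrArg Finset.card image_eq
  have k_mem : k ∈ Finset.univ.filter fun x => ¬ x < τ x := by simp [h.apply_self]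
  rw [Finset.card_image_of_injective _ τ.injective] at card_eq
  rw [Fintype.card_subtype, ← Finset.card_univ,
    ← Finset.card_filter_add_card_filter_not (s := Finset.univ) fun x => x < τ x,
    ← Finset.card_erase_add_one k_mem, ← card_eq]
  ring

end IsPairing

end Pairing

section CliffordClass

variable {n : ℕ} {τ τ' π : Equiv.Perm (Fin (2 * n + 1))} {k k' : Fin (2 * n + 1)}
  {A B : Finset (Fin (2 * n))} {U : Matrix.unitaryGroup (Fin n → Fin 2) ℂ}

/-- The subsets of `{0, …, 2n-1}` whose syndrome is invariant under `τ`. -/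
def invariantSets (τ : Equiv.Perm (Fin (2 * n + 1))) : Finset (Finset (Fin (2 * n))) :=
  Finset.univ.filter fun A => ∀ x, syndrome A (τ x) = syndrome A x

theorem mem_invariantSets : A ∈ invariantSets τ ↔ ∀ x, syndrome A (τ x) = syndrome A x := by
  simp [invariantSets]

theorem syndrome_empty (x : Fin (2 * n + 1)) : syndrome ∅ x = 0 :=
  Finset.sum_empty

theorem empty_mem_invariantSets (τ : Equiv.Perm (Fin (2 * n + 1))) : ∅ ∈ invariantSets τ := by
  simp [mem_invariantSets, syndrome_empty]

theorem exists_syndrome_apply_eq (π : Equiv.Perm (Fin (2 * n + 1))) (A : Finset (Fin (2 * n))) :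
    ∃ B, ∀ x, syndrome B (π x) = syndrome A x := by
  obtain ⟨B, hB⟩ := exists_syndrome_eq (f := syndrome A ∘ π.symm) <| by
    rw [← sum_syndrome A]
    exact Equiv.sum_comp π.symm (syndrome A)
  exact ⟨B, fun x => by rw [hB, Function.comp_apply, Equiv.symm_apply_apply]⟩

theorem mem_invariantSets_conj_iff (hAB : ∀ x, syndrome B (π x) = syndrome A x) :
    B ∈ invariantSets (π * τ * π⁻¹) ↔ A ∈ invariantSets τ := by
  rw [mem_invariantSets, mem_invariantSets, ← π.forall_congr_right]
  simp [hAB]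

/-- The class of commuting Clifford products attached to `τ`, without the identity. -/
def cliffordClass (τ : Equiv.Perm (Fin (2 * n + 1))) : Set (Op n) :=
  cliffordProduct n '' (invariantSets τ).erase ∅

theorem mem_cliffordClass_iff {Q : Op n} :
    Q ∈ cliffordClass τ ↔ ∃ A ∈ invariantSets τ, A ≠ ∅ ∧ cliffordProduct n A = Q := by
  simp [cliffordClass, and_assoc]

theorem cliffordClass_subset (τ : Equiv.Perm (Fin (2 * n + 1))) :
    cliffordClass τ ⊆ cliffordProducts n \ {1} := by
  intro Q hQ
  obtain ⟨A, -, A_ne, rfl⟩ := mem_cliffordClass_iff.1 hQ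
  refine ⟨⟨A, rfl⟩, ?_⟩
  rw [Set.mem_singleton_iff, ← cliffordProduct_empty]
  exact (isTraceOrthogonal_cliffordProduct n).injective.ne A_ne

theorem disjoint_cliffordClass (h : invariantSets τ ∩ invariantSets τ' = {∅}) :
    Disjoint (cliffordClass τ) (cliffordClass τ') := by
  refine Set.disjoint_image_of_injective (isTraceOrthogonal_cliffordProduct n).injective ?_
  rw [Finset.disjoint_coe, Finset.disjoint_left]
  intro A hA hA'
  rw [Finset.mem_erase] at hA hA'
  exact hA.1 (Finset.mem_singleton.1 (h ▸ Finset.mem_inter.2 ⟨hA.2, hA'.2⟩))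

theorem Implements.conj_mem_cliffordClass (hU : Implements U π) {Q : Op n}
    (hQ : Q ∈ cliffordClass τ) :
    (U : Op n) * Q * (U : Op n)ᴴ ∈ cliffordClass (π * τ * π⁻¹) ∨
      -((U : Op n) * Q * (U : Op n)ᴴ) ∈ cliffordClass (π * τ * π⁻¹) := by
  obtain ⟨A, hA, A_ne, rfl⟩ := mem_cliffordClass_iff.1 hQ
  obtain ⟨B, hAB⟩ := exists_syndrome_apply_eq π A
  have B_ne : B ≠ ∅ := by
    rintro rfl
    exact A_ne (syndrome_injective (funext fun x => by rw [← hAB, syndrome_empty, syndrome_empty]))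
  have B_mem : cliffordProduct n B ∈ cliffordClass (π * τ * π⁻¹) :=
    mem_cliffordClass_iff.2 ⟨B, (mem_invariantSets_conj_iff hAB).2 hA, B_ne, rfl⟩
  rcases hU.conj_cliffordProduct hAB with h | h
  · exact .inl (by rwa [h])
  · exact .inr (by rwa [h, neg_neg])

/-- Every vector of `B` is an eigenvector of every Clifford product in the class of `τ`. -/
def IsJointEigenbasis (τ : Equiv.Perm (Fin (2 * n + 1)))
    (B : OrthonormalBasis (Fin (2 ^ n)) ℂ (Qubits n)) : Prop :=
  ∀ A ∈ invariantSets τ, ∀ b, ∃ μ : ℂ, toEuclideanLin (cliffordProduct n A) (B b) = μ • B b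

namespace IsJointEigenbasis

variable {B B' : OrthonormalBasis (Fin (2 ^ n)) ℂ (Qubits n)}

theorem hasEigenvector (hB : IsJointEigenbasis τ B) {Q : Op n} (hQ : Q ∈ cliffordClass τ)
    (b : Fin (2 ^ n)) : ∃ μ : ℂ, Module.End.HasEigenvector (toEuclideanLin Q) μ (B b) := by
  obtain ⟨A, hA, -, rfl⟩ := mem_cliffordClass_iff.1 hQ
  obtain ⟨μ, hμ⟩ := hB A hA b
  exact ⟨μ, Module.End.mem_eigenspace_iff.2 hμ, B.orthonormal.ne_zero b⟩

theorem map_unitaryIsometry (hB : IsJointEigenbasis τ B) (hU : Implements U π) :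
    IsJointEigenbasis (π * τ * π⁻¹) (B.map (unitaryIsometry U)) := by
  intro A hA b
  obtain ⟨A', hA'⟩ : ∃ A', ∀ x, syndrome A (π x) = syndrome A' x := by
    obtain ⟨A', hA'⟩ := exists_syndrome_apply_eq π⁻¹ A
    exact ⟨A', fun x => by simp [← hA']⟩
  obtain ⟨μ, hμ⟩ := hB A' ((mem_invariantSets_conj_iff hA').1 hA) b
  have toEuclideanLin_mul (S T : Op n) (v : Qubits n) :
      toEuclideanLin S (toEuclideanLin T v) = toEuclideanLin (S * T) v := by
    rw [toLpLin_mul_same, LinearMap.comp_apply]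
  have conj_mul (T : Op n) : (U : Op n) * T * (U : Op n)ᴴ * U = U * T := by
    rw [mul_assoc, ← star_eq_conjTranspose, mem_unitaryGroup_iff'.1 U.2, mul_one]
  rw [OrthonormalBasis.map_apply, unitaryIsometry_apply, toEuclideanLin_mul]
  rcases hU.conj_cliffordProduct hA' with h | h
  · refine ⟨μ, ?_⟩
    rw [← h, conj_mul, ← toEuclideanLin_mul, hμ, map_smul]
  · refine ⟨-μ, ?_⟩
    rw [← neg_eq_iff_eq_neg.2 h, neg_mul, conj_mul, map_neg, LinearMap.neg_apply,
      ← toEuclideanLin_mul, hμ, map_smul, neg_smul]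

end IsJointEigenbasis

namespace IsPairing

theorem syndrome_apply_eq_zero (h : IsPairing τ k) (hA : A ∈ invariantSets τ) :
    syndrome A k = 0 := by
  rw [← h.sum_eq (mem_invariantSets.1 hA), sum_syndrome]

theorem card_invariantSets (h : IsPairing τ k) : (invariantSets τ).card = 2 ^ n := by
  have bijective : Function.Bijective fun (A : invariantSets τ) (x : {x // x < τ x}) =>
      syndrome A.1 x := by
    refine ⟨fun A B hAB => Subtype.ext (syndrome_injective ?_), fun g => ?_⟩
    · exact h.eq_of_eq_of_lt_apply (mem_invariantSets.1 A.2) (mem_invariantSets.1 B.2)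
        (by rw [h.syndrome_apply_eq_zero A.2, h.syndrome_apply_eq_zero B.2])
        fun x hx => congrFun hAB ⟨x, hx⟩
    · obtain ⟨f, f_inv, f_k, hf⟩ := h.exists_extension g 0
      obtain ⟨A, rfl⟩ := exists_syndrome_eq ((h.sum_eq f_inv).trans f_k)
      exact ⟨⟨A, mem_invariantSets.2 f_inv⟩, funext hf⟩
  have card_lt := h.two_mul_card_lt_apply_add_one
  rw [Fintype.card_fin] at card_lt
  rw [← Fintype.card_coe, Fintype.card_of_bijective bijective, Fintype.card_fun, ZMod.card,
    show Fintype.card {x // x < τ x} = n by omega]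

theorem commute_cliffordProduct (h : IsPairing τ k) (hA : A ∈ invariantSets τ)
    (hB : B ∈ invariantSets τ) : Commute (cliffordProduct n A) (cliffordProduct n B) := by
  have sum_eq_zero : ∑ x, syndrome A x * syndrome B x = 0 := by
    rw [h.sum_eq fun x => by rw [mem_invariantSets.1 hA, mem_invariantSets.1 hB],
      h.syndrome_apply_eq_zero hA, zero_mul]
  rw [← signCommute_zero_iff, ← sum_eq_zero]
  exact signCommute_cliffordProduct A B

theorem commute_of_mem_cliffordClass (h : IsPairing τ k) {Q Q' : Op n} (hQ : Q ∈ cliffordClass τ)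
    (hQ' : Q' ∈ cliffordClass τ) : Commute Q Q' := by
  obtain ⟨A, hA, -, rfl⟩ := mem_cliffordClass_iff.1 hQ
  obtain ⟨B, hB, -, rfl⟩ := mem_cliffordClass_iff.1 hQ'
  exact h.commute_cliffordProduct hA hB

theorem ncard_cliffordClass (h : IsPairing τ k) : (cliffordClass τ).ncard = 2 ^ n - 1 := by
  rw [cliffordClass, Set.ncard_image_of_injective _ (isTraceOrthogonal_cliffordProduct n).injective,
    Set.ncard_coe_finset, Finset.card_erase_of_mem (empty_mem_invariantSets τ),
    h.card_invariantSets]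

theorem Γ_mem_cliffordClass_iff (h : IsPairing τ k) (hn : 0 < n) (x : Fin (2 * n + 1)) :
    Γ n x ∈ cliffordClass τ ↔ x = k := by
  have : Nontrivial (Fin (2 * n + 1)) := Fin.nontrivial_iff_two_le.2 (by omega)
  obtain ⟨A, A_eq, hA⟩ := exists_cliffordProduct_eq_Γ x
  obtain ⟨y, hy⟩ := exists_ne x
  have A_ne : A ≠ ∅ := by
    rintro rfl
    simpa [hy, syndrome_empty] using hA y
  rw [← A_eq, cliffordClass, (isTraceOrthogonal_cliffordProduct n).injective.mem_set_image,
    Finset.mem_coe, Finset.mem_erase, and_iff_right A_ne, mem_invariantSets]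
  refine ⟨fun h_inv => (h.apply_eq_iff x).1 ?_, ?_⟩
  · simpa [hA] using h_inv x
  · rintro rfl y
    have apply_eq : τ y = x ↔ y = x := by
      rw [h.involutive.eq_iff, h.apply_self, eq_comm]
    simp only [hA, apply_eq]

theorem existsUnique_Γ_mem_cliffordClass (h : IsPairing τ k) (hn : 0 < n) :
    ∃! x : Fin (2 * n + 1), Γ n x ∈ cliffordClass τ :=
  ⟨k, (h.Γ_mem_cliffordClass_iff hn k).2 rfl, fun x => (h.Γ_mem_cliffordClass_iff hn x).1⟩

theorem exists_isJointEigenbasis (h : IsPairing τ k) : ∃ B, IsJointEigenbasis τ B := by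
  obtain ⟨B, hB⟩ := exists_orthonormalBasis_eigenvectors (d := 2 ^ n) (by simp)
    (T := fun A : invariantSets τ => toEuclideanLin (cliffordProduct n A))
    (fun A => isSymmetric_toEuclideanLin_iff.2 (isSelfAdjoint_cliffordProduct A.1))
    (fun A B _ => ((h.commute_cliffordProduct A.2 B.2).map (toEuclideanCLM (𝕜 := ℂ))).map
      ContinuousLinearMap.toLinearMapRingHom)
  exact ⟨B, fun A hA b => hB b ⟨A, hA⟩⟩

theorem mutuallyUnbiased (h : IsPairing τ k) (h' : IsPairing τ' k')
    (h_inter : invariantSets τ ∩ invariantSets τ' = {∅})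
    {B B' : OrthonormalBasis (Fin (2 ^ n)) ℂ (Qubits n)} (hB : IsJointEigenbasis τ B)
    (hB' : IsJointEigenbasis τ' B') : MutuallyUnbiased B B' := by
  intro a b
  rw [(isTraceOrthogonal_cliffordProduct n).norm_inner_eq_of_inter_eq_singleton
    (by simp [h.card_invariantSets]) (by simp [h'.card_invariantSets]) (cliffordProduct_empty n)
    h_inter (B.orthonormal.1 a) (B'.orthonormal.1 b) (fun A hA => hB A hA a) fun A hA => hB' A hA b]
  simp

end IsPairing

end CliffordClass

section CyclicPairing

/-- `σ` is an even permutation of order dividing `L` and `τ` an involution with the single fixed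
point `k`, such that `τ` together with its conjugate by any nontrivial power of `σ` acts
transitively: every function that is invariant under both is constant. The conjugates of `τ` then
define `L` classes of Clifford products that are cyclically permuted. -/
structure IsCyclicPairing {P : Type*} [Fintype P] [DecidableEq P] (L : ℕ) (σ τ : Equiv.Perm P)
    (k : P) : Prop where
  sign_eq_one : Equiv.Perm.sign σ = 1
  pow_eq_one : σ ^ L = 1
  isPairing : IsPairing τ k
  eq_of_invariant : ∀ j : ℕ, ¬ L ∣ j → ∀ f : P → ZMod 2, (∀ x, f (τ x) = f x) →
    (∀ x, f ((σ ^ j) (τ x)) = f ((σ ^ j) x)) → ∀ x, f x = f k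

/-- The conjugate of `τ` by the power `σ ^ j`; the exponent makes sense modulo `L` if
`σ ^ L = 1`. -/
def rotate {P : Type*} {L : ℕ} (σ τ : Equiv.Perm P) (j : ZMod L) : Equiv.Perm P :=
  σ ^ j.val * τ * (σ ^ j.val)⁻¹

theorem pow_val_add {M : Type*} [Monoid M] {L : ℕ} [NeZero L] {x : M} (hx : x ^ L = 1)
    (i j : ZMod L) : x ^ (i + j).val = x ^ i.val * x ^ j.val := by
  rw [ZMod.val_add, ← pow_eq_pow_mod _ hx, pow_add]

theorem pow_val_add_one {M : Type*} [Monoid M] {L : ℕ} [Fact (1 < L)] {x : M} (hx : x ^ L = 1)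
    (j : ZMod L) : x ^ (j + 1).val = x * x ^ j.val := by
  have : NeZero L := ⟨(zero_lt_one.trans Fact.out).ne'⟩
  rw [add_comm, pow_val_add hx, ZMod.val_one, pow_one]

namespace IsCyclicPairing

variable {P Q : Type*} [Fintype P] [DecidableEq P] [Fintype Q] [DecidableEq Q] {L : ℕ}
  {σ τ : Equiv.Perm P} {k : P}

theorem permCongr (h : IsCyclicPairing L σ τ k) (e : P ≃ Q) :
    IsCyclicPairing L (e.permCongr σ) (e.permCongr τ) (e k) := by
  have permCongr_pow (j : ℕ) : e.permCongr σ ^ j = e.permCongr (σ ^ j) :=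
    (map_pow e.permCongrHom σ j).symm
  refine ⟨?_, ?_, h.isPairing.permCongr e, fun j hj f hf hfj x => ?_⟩
  · rw [Equiv.Perm.sign_permCongr, h.sign_eq_one]
  · rw [permCongr_pow, h.pow_eq_one]
    exact e.permCongr_refl
  · rw [permCongr_pow] at hfj
    simpa using h.eq_of_invariant j hj (f ∘ e) (fun y => by simpa using hf (e y))
      (fun y => by simpa using hfj (e y)) (e.symm x)

theorem isPairing_rotate (h : IsCyclicPairing L σ τ k) (j : ZMod L) :
    IsPairing (rotate σ τ j) ((σ ^ j.val) k) :=
  h.isPairing.conj _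

theorem conj_rotate [Fact (1 < L)] (h : IsCyclicPairing L σ τ k) (j : ZMod L) :
    σ * rotate σ τ j * σ⁻¹ = rotate σ τ (j + 1) := by
  rw [rotate, rotate, pow_val_add_one h.pow_eq_one]
  group

theorem inter_invariantSets [NeZero L] {n : ℕ} {σ τ : Equiv.Perm (Fin (2 * n + 1))}
    {k : Fin (2 * n + 1)} (h : IsCyclicPairing L σ τ k) {i j : ZMod L} (hij : i ≠ j) :
    invariantSets (rotate σ τ i) ∩ invariantSets (rotate σ τ j) = {∅} := by
  ext A
  rw [Finset.mem_inter, Finset.mem_singleton]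
  refine ⟨fun ⟨hi, hj⟩ => syndrome_injective ?_,
    fun hA => hA ▸ ⟨empty_mem_invariantSets _, empty_mem_invariantSets _⟩⟩
  have not_dvd : ¬ L ∣ (j - i).val := fun hd => by
    have := Nat.eq_zero_of_dvd_of_lt hd (ZMod.val_lt _)
    rw [ZMod.val_eq_zero, sub_eq_zero] at this
    exact hij this.symm
  have pow_sub (x) : (σ ^ i.val) ((σ ^ (j - i).val) x) = (σ ^ j.val) x := by
    rw [← Equiv.Perm.mul_apply, ← pow_val_add h.pow_eq_one, add_sub_cancel]
  have const := h.eq_of_invariant _ not_dvd (fun x => syndrome A ((σ ^ i.val) x))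
    (fun x => by simpa [rotate] using mem_invariantSets.1 hi ((σ ^ i.val) x))
    (fun x => by simpa [rotate, pow_sub] using mem_invariantSets.1 hj ((σ ^ j.val) x))
  refine funext ((σ ^ i.val).forall_congr_right.1 fun x => ?_)
  rw [const, (h.isPairing_rotate i).syndrome_apply_eq_zero hi, syndrome_empty]

end IsCyclicPairing
end CyclicPairing

section CyclicLink

theorem involutive_swap_mul {P : Type*} [DecidableEq P] {τ : Equiv.Perm P} {a b : P}
    (hτ : Function.Involutive τ) (hab : Equiv.swap (τ a) (τ b) = Equiv.swap a b) :
    Function.Involutive (Equiv.swap a b * τ) := by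
  intro x
  have comm : τ * Equiv.swap a b = Equiv.swap a b * τ := by
    rw [Equiv.mul_swap_eq_swap_mul, hab]
  change Equiv.swap a b ((τ * Equiv.swap a b) (τ x)) = x
  rw [comm, Equiv.Perm.mul_apply, hτ x, Equiv.swap_apply_self]

/-- The analogue of `IsCyclicPairing` for an involution `μ` with two fixed points `p` and `q`. Such
links can be chained: one matches the end `q` of each link with the end `p` of the next. -/
structure IsCyclicLink {G : Type*} [Fintype G] [DecidableEq G] (L : ℕ) (s μ : Equiv.Perm G)
    (p q : G) : Prop where
  sign_eq_one : Equiv.Perm.sign s = 1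
  pow_eq_one : s ^ L = 1
  involutive : Function.Involutive μ
  ne : p ≠ q
  apply_eq_iff : ∀ x, μ x = x ↔ x = p ∨ x = q
  eq_of_invariant : ∀ j : ℕ, ¬ L ∣ j → ∀ f : G → ZMod 2, (∀ x, f (μ x) = f x) →
    (∀ x, f ((s ^ j) (μ x)) = f ((s ^ j) x)) → f p = f ((s ^ j) p) → ∀ x, f x = f p

variable {P G : Type*} [DecidableEq P] [DecidableEq G] {L : ℕ} {σ τ : Equiv.Perm P}
  {s μ : Equiv.Perm G} {k : P} {p q : G}

/-- The action of `τ` and `μ` on the two parts of `P ⊕ G`, except that the fixed points `k` of `τ`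
and `p` of `μ` are exchanged. -/
def joinPairing (τ : Equiv.Perm P) (μ : Equiv.Perm G) (k : P) (p : G) : Equiv.Perm (P ⊕ G) :=
  Equiv.swap (.inl k) (.inr p) * Equiv.sumCongr τ μ

theorem joinPairing_apply_of_ne {x : P ⊕ G} (hl : Equiv.sumCongr τ μ x ≠ .inl k)
    (hr : Equiv.sumCongr τ μ x ≠ .inr p) : joinPairing τ μ k p x = Equiv.sumCongr τ μ x :=
  Equiv.swap_apply_of_ne_of_ne hl hr

theorem eq_of_joinPairing_invariant (hk : τ k = k) {α : Type*} {f : P ⊕ G → α}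
    (hf : ∀ x, f (joinPairing τ μ k p x) = f x) :
    f (.inr p) = f (.inl k) ∧ ∀ x, f (Equiv.sumCongr τ μ x) = f x := by
  have join_eq : f (.inr p) = f (.inl k) := by
    simpa [joinPairing, hk] using hf (.inl k)
  refine ⟨join_eq, fun x => ?_⟩
  rw [← hf x, joinPairing, Equiv.Perm.mul_apply, Equiv.swap_apply_def]
  split_ifs with h h <;> simp [h, join_eq]

variable [Fintype G]

theorem IsCyclicLink.isPairing_joinPairing (hμ : IsCyclicLink L s μ p q) (hτ : IsPairing τ k) :
    IsPairing (joinPairing τ μ k p) (.inr q) where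
  involutive := involutive_swap_mul
    (by rintro (x | x) <;> simp [hτ.involutive _, hμ.involutive _])
    (by simp [hτ.apply_self, (hμ.apply_eq_iff p).2])
  apply_eq_iff := by
    have μ_p : μ p = p := (hμ.apply_eq_iff p).2 (.inl rfl)
    rintro (x | x)
    · by_cases hx : x = k
      · simp [joinPairing, hx, hτ.apply_self]
      · have τ_ne : τ x ≠ k := hτ.apply_self ▸ τ.injective.ne hx
        rw [joinPairing_apply_of_ne (by simpa using τ_ne) (by simp)]
        simp [hτ.apply_eq_iff, hx]
    · by_cases hx : x = p
      · simp [joinPairing, hx, μ_p, hμ.ne]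
      · have μ_ne : μ x ≠ p := μ_p ▸ μ.injective.ne hx
        rw [joinPairing_apply_of_ne (by simp) (by simpa using μ_ne)]
        simp [hμ.apply_eq_iff, hx]

theorem IsCyclicLink.isCyclicPairing_joinPairing [Fintype P] (hμ : IsCyclicLink L s μ p q)
    (hτ : IsCyclicPairing L σ τ k) :
    IsCyclicPairing L (Equiv.sumCongr σ s) (joinPairing τ μ k p) (.inr q) := by
  have sumCongr_pow (j : ℕ) : Equiv.sumCongr σ s ^ j = Equiv.sumCongr (σ ^ j) (s ^ j) :=
    (map_pow (Equiv.Perm.sumCongrHom P G) (σ, s) j).symm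
  refine ⟨?_, ?_, hμ.isPairing_joinPairing hτ.isPairing, fun j hj f hf hfj => ?_⟩
  · rw [Equiv.Perm.sign_sumCongr, hτ.sign_eq_one, hμ.sign_eq_one, one_mul]
  · rw [sumCongr_pow, hτ.pow_eq_one, hμ.pow_eq_one]
    exact Equiv.Perm.sumCongr_one
  · rw [sumCongr_pow] at hfj
    obtain ⟨join_eq, f_inv⟩ := eq_of_joinPairing_invariant hτ.isPairing.apply_self hf
    obtain ⟨join_eq', f_inv'⟩ := eq_of_joinPairing_invariant hτ.isPairing.apply_self
      (f := f ∘ Equiv.sumCongr (σ ^ j) (s ^ j)) hfj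
    have const_left := hτ.eq_of_invariant j hj (f ∘ .inl) (fun x => f_inv (.inl x))
      (fun x => f_inv' (.inl x))
    have const_right := hμ.eq_of_invariant j hj (f ∘ .inr) (fun x => f_inv (.inr x))
      (fun x => f_inv' (.inr x)) (join_eq.trans ((const_left _).symm.trans join_eq'.symm))
    simp only [Function.comp_apply] at const_left const_right
    rintro (x | x) <;> simp only [const_left, const_right, join_eq]

end CyclicLink

section Dihedral

variable {L : ℕ} [Fact L.Prime]

theorem ringChar_zmod_ne_two (hL : L ≠ 2) : ringChar (ZMod L) ≠ 2 := by
  rwa [ZMod.ringChar_zmod_n]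

theorem eq_of_periodic {α : Type*} {f : ZMod L → α} {a : ZMod L} (ha : a ≠ 0)
    (hf : ∀ x, f (x + a) = f x) (x : ZMod L) : f x = f 0 := by
  have apply_mul (m : ℕ) : f (m * a) = f 0 := by
    induction m with
    | zero => simp
    | succ m ih => rw [Nat.cast_succ, add_mul, one_mul, hf, ih]
  simpa [div_mul_cancel₀ x ha] using apply_mul (x / a).val

theorem isPairing_neg (hL : L ≠ 2) : IsPairing (Equiv.neg (ZMod L)) 0 where
  involutive := neg_neg
  apply_eq_iff _ := Ring.eq_self_iff_eq_zero_of_char_ne_two (ringChar_zmod_ne_two hL)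

theorem eq_of_symmetric {α : Type*} (hL : L ≠ 2) {f : ZMod L → α} {j : ZMod L} (hj : j ≠ 0)
    (hf : ∀ x, f (-x) = f x) (hfj : ∀ x, f (-x + j) = f (x + j)) (x : ZMod L) : f x = f 0 := by
  have two_ne : (2 : ZMod L) ≠ 0 := Ring.two_ne_zero (ringChar_zmod_ne_two hL)
  refine eq_of_periodic (mul_ne_zero two_ne hj) (fun y => ?_) x
  calc f (y + 2 * j) = f (-(-y - j) + j) := by ring_nf
    _ = f y := by rw [hfj, sub_add_cancel, hf]

theorem eq_of_symmetric_of_ne {R : Type*} [CommRing R] [CharP R 2] (hL : L ≠ 2) {f : ZMod L → R}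
    {j : ZMod L} (hj : j ≠ 0) (hf : ∀ x, x ≠ 1 → x ≠ -1 → f (-x) = f x)
    (hfj : ∀ x, x ≠ 1 → x ≠ -1 → f (-x + j) = f (x + j)) (h_zero : f 0 = f j)
    (h_one : f 1 = f (1 + j)) (h_neg_one : f (-1) = f (-1 + j)) (x : ZMod L) : f x = f 0 := by
  -- The defect `d` of both symmetries vanishes: `f x + f (x + j) + d x` has period `j`, and its
  -- values at `0` and `1` are `0` and `d 1`.
  let d (x : ZMod L) : R := if x = 1 ∨ x = -1 then f 1 + f (-1) else 0
  have defect (x) : f (-x) = f x + d x := by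
    by_cases hx : x = 1 ∨ x = -1
    · rcases hx with rfl | rfl <;> simp [d] <;> grind
    · simp only [d, hx, if_false, add_zero]
      exact hf x (fun h => hx (.inl h)) fun h => hx (.inr h)
  have defect_shift (x) : f (-x + j) = f (x + j) + d x := by
    by_cases hx : x = 1 ∨ x = -1
    · rcases hx with rfl | rfl <;> simp [d] <;> grind
    · simp only [d, hx, if_false, add_zero]
      exact hfj x (fun h => hx (.inl h)) fun h => hx (.inr h)
  have d_zero : d 0 = 0 := by simp [d]
  have d_one : d 1 = 0 := by
    have periodic := eq_of_periodic (f := fun x => f x + f (x + j) + d x) hj (fun x => by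
      have h := defect_shift (x + j)
      rw [show -(x + j) + j = -x by ring, defect] at h
      grind) 1
    simpa [d_zero, ← h_zero, ← h_one, CharTwo.add_self_eq_zero] using periodic
  have d_eq_zero (x) : d x = 0 := by
    simp only [d, true_or, if_true] at d_one
    simp [d, d_one]
  exact eq_of_symmetric hL hj (by simpa only [d_eq_zero, add_zero] using defect)
    (by simpa only [d_eq_zero, add_zero] using defect_shift) x

theorem isCyclicPairing_neg (hL : L ≠ 2) :
    IsCyclicPairing L (Equiv.addRight (1 : ZMod L)) (Equiv.neg (ZMod L)) 0 := by
  have pow_eq_one : Equiv.addRight (1 : ZMod L) ^ L = 1 := by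
    ext x
    simp
  refine ⟨?_, pow_eq_one, isPairing_neg hL, fun j hj f hf hfj => ?_⟩
  · have sign_pow := congrArg Equiv.Perm.sign pow_eq_one
    have odd_L : Odd L := (Fact.out : L.Prime).odd_of_ne_two hL
    rwa [map_pow, map_one, Int.units_pow_eq_pow_mod_two, Nat.odd_iff.1 odd_L, pow_one] at sign_pow
  · have j_ne : (j : ZMod L) ≠ 0 := by rwa [Ne, ZMod.natCast_eq_zero_iff]
    exact eq_of_symmetric hL j_ne hf (by simpa using hfj)

end Dihedral

section ConcreteLinks

/-- The simultaneous cyclic shift of two blocks of length `L`. Blocks are taken in pairs so that the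
shift is even also for `L = 2`. -/
def shiftPair (L : ℕ) : Equiv.Perm (Fin 2 × ZMod L) :=
  Equiv.prodCongrRight fun _ => Equiv.addRight 1

theorem shiftPair_apply {L : ℕ} (c : Fin 2) (x : ZMod L) : shiftPair L (c, x) = (c, x + 1) :=
  rfl

theorem shiftPair_pow_apply {L : ℕ} (j : ℕ) (c : Fin 2) (x : ZMod L) :
    (shiftPair L ^ j) (c, x) = (c, x + j) := by
  induction j with
  | zero => simp
  | succ j ih => simp [pow_succ', ih, shiftPair_apply, add_assoc]

theorem shiftPair_pow_self (L : ℕ) : shiftPair L ^ L = 1 := by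
  ext1 ⟨c, x⟩
  simp [shiftPair_pow_apply]

theorem sign_shiftPair (L : ℕ) [NeZero L] : Equiv.Perm.sign (shiftPair L) = 1 := by
  rw [shiftPair, Equiv.Perm.sign_prodCongrRight, Fin.prod_univ_two, Int.units_mul_self]

theorem isCyclicLink_two :
    IsCyclicLink 2 (shiftPair 2) (Equiv.swap (0, 1) (1, 0)) (0, 0) (1, 1) where
  sign_eq_one := sign_shiftPair 2
  pow_eq_one := shiftPair_pow_self 2
  involutive := Equiv.swap_apply_self _ _
  ne := by decide
  apply_eq_iff := by decide
  eq_of_invariant j hj f hf hfj h_zero := by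
    have j_eq : (j : ZMod 2) = 1 := ZMod.natCast_eq_one_iff_odd.2 (Nat.odd_iff.2 (by omega))
    have h := hf (0, 1)
    have hj := hfj (0, 1)
    rw [Equiv.swap_apply_left] at h hj
    simp only [shiftPair_pow_apply, j_eq] at hj h_zero
    have one_add_one : (1 + 1 : ZMod 2) = 0 := CharTwo.add_self_eq_zero 1
    simp only [zero_add, one_add_one] at hj h_zero
    rintro ⟨c, x⟩
    fin_cases c <;> fin_cases x
    exacts [rfl, h_zero.symm, h.trans h_zero.symm, hj]

/-- The inversion of both of two blocks of odd length `L`, except that `1` in block `0` is matched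
with `0` in block `1`; this leaves `0` and `-1` in block `0` fixed, the two ends of a link. -/
def reflectPair (L : ℕ) : Equiv.Perm (Fin 2 × ZMod L) :=
  Equiv.swap (0, 1) (1, 0) * (Equiv.swap (0, 1) (0, -1) * Equiv.prodCongrRight fun _ => Equiv.neg _)

variable {L : ℕ} [Fact L.Prime]

theorem involutive_reflectPair : Function.Involutive (reflectPair L) := by
  refine involutive_swap_mul (involutive_swap_mul ?_ ?_) ?_
  · rintro ⟨c, x⟩
    simp
  · simp [Equiv.swap_comm]
  · simp [Equiv.swap_apply_def]

theorem reflectPair_one : reflectPair L (0, 1) = (1, 0) := by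
  simp [reflectPair]

theorem reflectPair_neg_one (hL : L ≠ 2) : reflectPair L (0, -1) = (0, -1) := by
  simp [reflectPair, Equiv.swap_apply_of_ne_of_ne,
    Ring.neg_one_ne_one_of_char_ne_two (ringChar_zmod_ne_two hL)]

theorem reflectPair_apply_of_ne {c : Fin 2} {x : ZMod L} (h_one : (c, x) ≠ (0, 1))
    (h_neg_one : (c, x) ≠ (0, -1)) (h_zero : (c, x) ≠ (1, 0)) : reflectPair L (c, x) = (c, -x) := by
  have apply_ne_one : (c, -x) ≠ (0, 1) := by simpa [neg_eq_iff_eq_neg] using h_neg_one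
  have apply_ne_neg_one : (c, -x) ≠ (0, -1) := by simpa using h_one
  have apply_ne_zero : (c, -x) ≠ (1, 0) := by simpa using h_zero
  simp only [reflectPair, Equiv.Perm.mul_apply, Equiv.prodCongrRight_apply, Equiv.neg_apply]
  rw [Equiv.swap_apply_of_ne_of_ne apply_ne_one apply_ne_neg_one,
    Equiv.swap_apply_of_ne_of_ne apply_ne_one apply_ne_zero]

theorem reflectPair_zero : reflectPair L (1, 0) = (0, 1) :=
  (involutive_reflectPair.eq_iff.1 reflectPair_one).symm

theorem reflectPair_apply_eq_iff (hL : L ≠ 2) (y : Fin 2 × ZMod L) :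
    reflectPair L y = y ↔ y = (0, 0) ∨ y = (0, -1) := by
  obtain ⟨c, x⟩ := y
  have neg_one_ne := Ring.neg_one_ne_one_of_char_ne_two (ringChar_zmod_ne_two hL)
  by_cases h_one : (c, x) = (0, 1)
  · simp [h_one, reflectPair_one, neg_one_ne.symm]
  by_cases h_zero : (c, x) = (1, 0)
  · simp [h_zero, reflectPair_zero]
  by_cases h_neg_one : (c, x) = (0, -1)
  · simp [h_neg_one, reflectPair_neg_one hL]
  · have c_eq (hx : x = 0) : c = 0 := by
      by_contra hc
      exact h_zero (by rw [hx, Fin.eq_one_of_ne_zero c hc])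
    rw [reflectPair_apply_of_ne h_one h_neg_one h_zero, or_iff_left h_neg_one, Prod.mk_right_inj,
      Ring.eq_self_iff_eq_zero_of_char_ne_two (ringChar_zmod_ne_two hL)]
    exact ⟨fun hx => by rw [hx, c_eq hx], fun h => congrArg Prod.snd h⟩

theorem eq_of_reflectPair_invariant {α : Type*} {f : Fin 2 × ZMod L → α}
    (hf : ∀ y, f (reflectPair L y) = f y) :
    f (0, 1) = f (1, 0) ∧ (∀ x, x ≠ 1 → x ≠ -1 → f (0, -x) = f (0, x)) ∧
      ∀ x, f (1, -x) = f (1, x) := by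
  refine ⟨by rw [← hf, reflectPair_one], fun x h_one h_neg_one => ?_, fun x => ?_⟩
  · rw [← hf (0, x), reflectPair_apply_of_ne] <;> simp [h_one, h_neg_one]
  · by_cases hx : x = 0
    · rw [hx, neg_zero]
    · rw [← hf (1, x), reflectPair_apply_of_ne] <;> simp [hx]

theorem sum_eq_of_reflectPair_invariant (hL : L ≠ 2) {R : Type*} [Semiring R] [CharP R 2]
    {f : Fin 2 × ZMod L → R} (hf : ∀ y, f (reflectPair L y) = f y) :
    ∑ y, f y = f (0, 0) + f (0, -1) := by
  have fixed_eq : (Finset.univ.filter fun y => reflectPair L y = y) = {(0, 0), (0, -1)} := by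
    ext y
    simp [reflectPair_apply_eq_iff hL]
  rw [sum_eq_sum_fixed involutive_reflectPair hf, fixed_eq, Finset.sum_pair (by simp)]

theorem isCyclicLink_reflectPair (hL : L ≠ 2) :
    IsCyclicLink L (shiftPair L) (reflectPair L) (0, 0) (0, -1) where
  sign_eq_one := sign_shiftPair L
  pow_eq_one := shiftPair_pow_self L
  involutive := involutive_reflectPair
  ne := by simp
  apply_eq_iff := reflectPair_apply_eq_iff hL
  eq_of_invariant j hj f hf hfj h_zero := by
    have j_ne : (j : ZMod L) ≠ 0 := by rwa [Ne, ZMod.natCast_eq_zero_iff]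
    have h_neg_one : f (0, -1) = f (0, -1 + j) := by
      have h_sum := sum_eq_of_reflectPair_invariant hL (f := f ∘ ⇑(shiftPair L ^ j)) hfj
      rw [show ∑ y, (f ∘ ⇑(shiftPair L ^ j)) y = ∑ y, f y from Equiv.sum_comp _ f,
        sum_eq_of_reflectPair_invariant hL hf, h_zero] at h_sum
      simpa [shiftPair_pow_apply] using h_sum
    obtain ⟨h_join, h₀, h₁⟩ := eq_of_reflectPair_invariant hf
    obtain ⟨h_join', h₀', h₁'⟩ := eq_of_reflectPair_invariant (f := f ∘ ⇑(shiftPair L ^ j)) hfj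
    simp only [Function.comp_apply, shiftPair_pow_apply, zero_add] at h_zero h_join' h₀' h₁'
    have const_one := eq_of_symmetric hL (f := fun x => f (1, x)) j_ne h₁ h₁'
    have h_one : f (0, 1) = f (0, 1 + j) := by rw [h_join, h_join', const_one j]
    have const_zero := eq_of_symmetric_of_ne hL (f := fun x => f (0, x)) j_ne h₀ h₀' h_zero h_one
      h_neg_one
    rintro ⟨c, x⟩
    fin_cases c
    · exact const_zero x
    · exact (const_one x).trans (h_join.symm.trans (const_zero 1))

end ConcreteLinks

section Chain

variable {G : Type*}

/-- The action of `s` on each of `m` copies of `G`, with an additional fixed point. -/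
def blockPerm (m : ℕ) (s : Equiv.Perm G) : Equiv.Perm (Option (Fin m × G)) :=
  (Equiv.prodCongrRight fun _ => s).optionCongr

theorem exists_equiv_semiconj_blockPerm_succ [Finite G] (m : ℕ) (s : Equiv.Perm G) :
    ∃ e : Option (Fin m × G) ⊕ G ≃ Option (Fin (m + 1) × G),
      e.permCongr (Equiv.sumCongr (blockPerm m s) s) = blockPerm (m + 1) s := by
  have := Fintype.ofFinite G
  let f : Option (Fin m × G) ⊕ G → Option (Fin (m + 1) × G) :=
    Sum.elim (Option.map (Prod.map Fin.castSucc id)) fun x => some (Fin.last m, x)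
  have injective_f : Function.Injective f := by
    refine Function.Injective.sumElim
      (Option.map_injective ((Fin.castSucc_injective m).prodMap Function.injective_id))
      ((Option.some_injective _).comp (Prod.mk_right_injective _)) ?_
    rintro (_ | ⟨b, x⟩) y <;> simp [(Fin.castSucc_lt_last _).ne]
  have bijective_f : Function.Bijective f :=
    (Fintype.bijective_iff_injective_and_card f).2 ⟨injective_f, by simp; ring⟩
  refine ⟨Equiv.ofBijective f bijective_f, Equiv.ext fun y => ?_⟩
  obtain ⟨y, rfl⟩ := (Equiv.ofBijective f bijective_f).surjective y
  rw [Equiv.permCongr_apply, Equiv.symm_apply_apply]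
  rcases y with ((_ | ⟨b, x⟩) | x) <;> rfl

theorem IsCyclicLink.exists_isCyclicPairing [Fintype G] [DecidableEq G] {L : ℕ}
    {s μ : Equiv.Perm G} {p q : G} (hμ : IsCyclicLink L s μ p q) (m : ℕ) :
    ∃ τ k, IsCyclicPairing L (blockPerm m s) τ k := by
  induction m with
  | zero =>
    exact ⟨1, none, by rw [Subsingleton.elim (blockPerm 0 s) 1, map_one], Subsingleton.elim _ _,
      ⟨fun _ => rfl, fun x => iff_of_true rfl (Subsingleton.elim x none)⟩,
      fun _ _ f _ _ x => congrArg f (Subsingleton.elim x none)⟩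
  | succ m ih =>
    obtain ⟨τ, k, h⟩ := ih
    obtain ⟨e, he⟩ := exists_equiv_semiconj_blockPerm_succ m s
    exact ⟨_, _, he ▸ (hμ.isCyclicPairing_joinPairing h).permCongr e⟩

end Chain

section Numbering

variable {n L : ℕ} [Fact L.Prime] {U : Matrix.unitaryGroup (Fin n → Fin 2) ℂ}

theorem exists_equiv_fin_val (N : ℕ) [NeZero N] : ∃ e : ZMod N ≃ Fin N, ∀ x, (e x : ℕ) = x.val := by
  cases N with
  | zero => exact absurd rfl (NeZero.ne 0)
  | succ N => exact ⟨Equiv.refl _, fun _ => rfl⟩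

theorem exists_equiv_blocks {m : ℕ} (hn : n = L * m) :
    ∃ e : Option (Fin m × Fin 2 × ZMod L) ≃ Fin (2 * n + 1), (e none : ℕ) = 2 * n ∧
      ∀ a c x, (e (some (a, c, x)) : ℕ) = L * (2 * a + c) + x.val := by
  obtain ⟨e, he⟩ := exists_equiv_fin_val L
  have card_eq : m * (2 * L) = 2 * n := by rw [hn]; ring
  let e' : Fin m × Fin 2 × ZMod L ≃ Fin (2 * n) :=
    ((Equiv.refl _).prodCongr (((Equiv.refl _).prodCongr e).trans finProdFinEquiv)).trans
      (finProdFinEquiv.trans (finCongr card_eq))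
  refine ⟨e'.optionCongr.trans finSuccEquivLast.symm, by simp, fun a c x => ?_⟩
  simp [e', he]
  ring

theorem cyclesGenerators_of_blocks {m : ℕ} (hn : n = L * m) (hn0 : 0 < n)
    {e : Option (Fin m × Fin 2 × ZMod L) ≃ Fin (2 * n + 1)} (he : (e none : ℕ) = 2 * n)
    (he' : ∀ a c x, (e (some (a, c, x)) : ℕ) = L * (2 * a + c) + x.val)
    (hU : Implements U (e.permCongr (blockPerm m (shiftPair L)))) :
    CyclesGenerators n L (U : Op n) := by
  have : Fact (1 < L) := ⟨(Fact.out : L.Prime).one_lt⟩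
  have conj_Γ (y) : (U : Op n) * Γ n (e y) * (U : Op n)ᴴ =
      Γ n (e (blockPerm m (shiftPair L) y)) := by
    rw [hU.conj_Γ, Equiv.permCongr_apply, Equiv.symm_apply_apply]
  refine ⟨fun hL => ?_, fun _ => ⟨fun x hx => ?_, ?_⟩⟩
  · have : L ≤ n := Nat.le_of_dvd hn0 ⟨m, hn⟩
    omega
  · obtain ⟨y, hy⟩ := e.surjective ⟨x, by omega⟩
    rcases y with (_ | ⟨a, c, y⟩)
    · simp [Fin.ext_iff, he] at hy
      omega
    · have x_eq : x = L * (2 * a + c) + y.val := by rw [← he', hy]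
      have x_div : x / L = 2 * a + c := by
        rw [x_eq, Nat.mul_add_div (NeZero.pos L), Nat.div_eq_of_lt (ZMod.val_lt y), add_zero]
      have x_mod : x % L = y.val := by
        rw [x_eq, Nat.mul_add_mod, Nat.mod_eq_of_lt (ZMod.val_lt y)]
      have conj_eq := conj_Γ (some (a, c, y))
      rwa [hy, show blockPerm m (shiftPair L) (some (a, c, y)) = some (a, c, y + 1) from rfl, he',
        ZMod.val_add, ZMod.val_one, ← x_div, ← x_mod] at conj_eq
  · simpa only [blockPerm, Equiv.optionCongr_apply, Option.map_none, he] using conj_Γ none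

theorem cyclesGenerators_of_addRight {N : ℕ} (hn0 : 0 < n) (hN : N = 2 * n + 1)
    {e : ZMod N ≃ Fin (2 * n + 1)} (he : ∀ x, (e x : ℕ) = x.val)
    (hU : Implements U (e.permCongr (Equiv.addRight 1))) : CyclesGenerators n N (U : Op n) := by
  have : Fact (1 < N) := ⟨by omega⟩
  refine ⟨fun _ x hx => ?_, fun h_dvd => ?_⟩
  · have conj_eq := hU.conj_Γ (e x)
    rwa [Equiv.permCongr_apply, Equiv.symm_apply_apply, he, he, ZMod.val_natCast,
      Nat.mod_eq_of_lt hx, Equiv.coe_addRight, ZMod.val_add, ZMod.val_natCast, ZMod.val_one,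
      Nat.mod_eq_of_lt hx] at conj_eq
  · have := Nat.le_of_dvd hn0 h_dvd
    omega

theorem exists_isCyclicPairing (hn0 : 0 < n) (h : L ∣ n ∨ L = 2 * n + 1) :
    ∃ (σ τ : Equiv.Perm (Fin (2 * n + 1))) (k : Fin (2 * n + 1)), IsCyclicPairing L σ τ k ∧
      ∀ U : unitaryGroup (Fin n → Fin 2) ℂ, Implements U σ → CyclesGenerators n L (U : Op n) := by
  rcases h with ⟨m, hn⟩ | rfl
  · obtain ⟨τ, k, hτ⟩ : ∃ τ k, IsCyclicPairing L (blockPerm m (shiftPair L)) τ k := by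
      by_cases hL : L = 2
      · subst hL
        exact isCyclicLink_two.exists_isCyclicPairing m
      · exact (isCyclicLink_reflectPair hL).exists_isCyclicPairing m
    obtain ⟨e, he, he'⟩ := exists_equiv_blocks hn
    exact ⟨_, _, _, hτ.permCongr e, fun U => cyclesGenerators_of_blocks hn hn0 he he'⟩
  · obtain ⟨e, he⟩ := exists_equiv_fin_val (2 * n + 1)
    exact ⟨_, _, _, (isCyclicPairing_neg (by omega)).permCongr e,
      fun U => cyclesGenerators_of_addRight hn0 rfl he⟩

end Numbering

end CyclicMUB

theorem theorem1 (n L : ℕ) (hL : L.Prime) (hL2 : 2 ≤ L) (hLn : L ≤ 2 * n + 1)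
    (h : L ∣ n ∨ L = 2 * n + 1) :
    ∃ (U : CyclicMUB.Op n) (C : ZMod L → Set (CyclicMUB.Op n))
      (B : ZMod L → OrthonormalBasis (Fin (2 ^ n)) ℂ (CyclicMUB.Qubits n)),
      -- `U` is a unitary that cyclically permutes the Clifford generators
      U ∈ Matrix.unitaryGroup (Fin n → Fin 2) ℂ ∧
      CyclicMUB.CyclesGenerators n L U ∧
      -- the classes consist of `d - 1` commuting Clifford products other than the identity,
      -- among them exactly one generator, and are disjoint
      (∀ j, C j ⊆ CyclicMUB.cliffordProducts n \ {1}) ∧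
      (∀ j, (C j).ncard = 2 ^ n - 1) ∧
      (∀ j, ∀ P ∈ C j, ∀ Q ∈ C j, Commute P Q) ∧
      (∀ j, ∃! k : Fin (2 * n + 1), CyclicMUB.Γ n k ∈ C j) ∧
      (∀ j k, j ≠ k → Disjoint (C j) (C k)) ∧
      -- `U` cyclically permutes the classes, up to the signs of the products
      (∀ j, ∀ P ∈ C j, U * P * U.conjTranspose ∈ C (j + 1) ∨
        -(U * P * U.conjTranspose) ∈ C (j + 1)) ∧
      -- `B j` is a common eigenbasis of the class `C j`
      (∀ j, ∀ P ∈ C j, ∀ b, ∃ μ : ℂ,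
        Module.End.HasEigenvector (Matrix.toEuclideanLin P) μ (B j b)) ∧
      -- the bases are mutually unbiased and are cyclically permuted by `U`
      (∀ j k, j ≠ k → CyclicMUB.MutuallyUnbiased (B j) (B k)) ∧
      (∀ j b, Matrix.toEuclideanLin U (B j b) = B (j + 1) b) := by
  open CyclicMUB in
  have : Fact L.Prime := ⟨hL⟩
  have : Fact (1 < L) := ⟨hL.one_lt⟩
  have hn : 0 < n := by omega
  obtain ⟨σ, τ, k, hτ, cycles⟩ := exists_isCyclicPairing hn h
  obtain ⟨U, hU, U_pow⟩ := exists_implements_pow_eq_one hL.pos hτ.sign_eq_one hτ.pow_eq_one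
  obtain ⟨B, hB⟩ := hτ.isPairing.exists_isJointEigenbasis
  have pairing (j) := hτ.isPairing_rotate j
  have inter_eq {i j} (hij : i ≠ j) := hτ.inter_invariantSets hij
  have eigenbasis (j : ZMod L) :
      IsJointEigenbasis (rotate σ τ j) (B.map (unitaryIsometry (U ^ j.val))) :=
    hB.map_unitaryIsometry (hU.pow j.val)
  refine ⟨U, fun j => cliffordClass (rotate σ τ j), fun j => B.map (unitaryIsometry (U ^ j.val)),
    U.2, cycles U hU, fun j => cliffordClass_subset _, fun j => (pairing j).ncard_cliffordClass,
    fun j P hP Q hQ => (pairing j).commute_of_mem_cliffordClass hP hQ,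
    fun j => (pairing j).existsUnique_Γ_mem_cliffordClass hn,
    fun i j hij => disjoint_cliffordClass (inter_eq hij), fun j P hP => ?_,
    fun j P hP b => (eigenbasis j).hasEigenvector hP b,
    fun i j hij => (pairing i).mutuallyUnbiased (pairing j) (inter_eq hij) (eigenbasis i)
      (eigenbasis j), fun j b => ?_⟩
  · simpa only [hτ.conj_rotate] using hU.conj_mem_cliffordClass hP
  · simp only [OrthonormalBasis.map_apply]
    rw [← unitaryIsometry_apply, pow_val_add_one U_pow, map_mul]
    rfl
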